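/- Let $G$ be a locally compact second countable Hausdorff topological group with left Haar measure $m$, and let $A$ be a discrete $G$-module, i.e. a discrete abelian group on which $G$ acts by automorphisms so that the action map $G\times A\to A$ is continuous. For $q\ge 0$ let $\mathcal C(G^q,A)$ be the group of $m^{q}$-a.e. equivalence classes of measurable functions $G^q\to A$ (with $\mathcal C(G^0,A)=A$; measurable means a.e. equal to a Borel function with countable range, which is automatic for Borel functions if $A$ is countable), with the diagonal action $(g\cdot\phi)(g_1,\dots,g_q)=g\cdot\phi(g^{-1}g_1,\dots,g^{-1}g_q)$ and the differential $$d\sigma(g_1,\dots,g_{q+1})=\sum_{i=1}^{q+1}(-1)^{q+1-i}\sigma(g_1,\dots,\widehat{g_i},\dots,g_{q+1}).$$ Let $\mathrm H^p_{\mathrm m}(G,A)$, $p\ge 0$, be the $p$-th cohomology group of the complex $\mathcal C(G,A)^G\xrightarrow{d}\mathcal C(G^2,A)^G\xrightarrow{d}\cdots$, in which $\mathcal C(G^{p+1},A)^G$ is placed in degree $p$ (so $\mathrm H^0_{\mathrm m}(G,A)=A^G$). (1) For every $p\ge 0$, every class in $\mathrm H^p_{\mathrm m}(G,A)$ is represented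 by a function $\sigma:G^{p+1}\to A$ that is $G$-equivariant and satisfies $d\sigma=0$ (both everywhere), that is locally finite-valued (every point of $G^{p+1}$ has a neighbourhood on which $\sigma$ takes only finitely many values), and that is locally constant on a dense open subset of $G^{p+1}$ whose complement is $m^{p+1}$-null. (2) Suppose moreover that $G$ is a closed algebraic subgroup of $\mathrm{GL}_n(\mathbb R)$ for some $n$, i.e. is identified, as a topological group, with a closed subgroup of $\mathrm{GL}_n(\mathbb R)$ that is the set of all invertible matrices at which a family of real polynomials in the $n^2$ matrix entries vanish. Then for every $p\ge 0$ every class in $\mathrm H^p_{\mathrm m}(G,A)$ is represented by a function $\sigma:G^{p+1}\to A$ that has all the properties in (1), that is constant on each cell of some locally finite partition of $G^{p+1}$ into semi-algebraic subsets of the real affine space $M_{n\times n}(\mathbb R)^{p+1}$, and that is constant on a neighbourhood of the origin $(e,\dots,e)$ of $G^{p+1}$. -/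

import Mathlib

open MeasureTheory Topology Filter

/-! ### The measurable homogeneous bar resolution

Throughout, `G` is a locally compact second countable group with a left Haar measure `μ`, and `A` is
a topological `G`-module. `G^q` is `Fin q → G` with the product measure. -/

namespace MooreCohomology

universe u v

/-- `G^q` carries the product of the Haar measures of the factors, a Haar measure of `G^q`. -/
noncomputable abbrev powMeasure {G : Type u} [MeasurableSpace G] (μ : Measure G) (q : ℕ) :
    Measure (Fin q → G) :=
  Measure.pi fun _ => μ

/-- `𝒞(G^q, A)`: the a.e. classes of (strongly) measurable functions `G^q → A`; for a Polish
module `A`, in particular for a countable discrete one, these are all measurable functions. (For `q = 0` the space `G^0` is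
one point of mass one, and this is `A` itself.) -/
abbrev Cochain {G : Type u} [MeasurableSpace G] (μ : Measure G) (A : Type v) [TopologicalSpace A]
    (q : ℕ) : Type (max u v) :=
  (Fin q → G) →ₘ[powMeasure μ q] A

/-- The diagonal left translation of `G^q` by `g`. -/
theorem measurePreserving_diag {G : Type u} [Group G] [MeasurableSpace G] [MeasurableMul G]
    (μ : Measure G) [SigmaFinite μ] [μ.IsMulLeftInvariant] (q : ℕ) (g : G) :
    MeasurePreserving (fun (x : Fin q → G) (i : Fin q) => g * x i) (powMeasure μ q)
      (powMeasure μ q) :=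
  measurePreserving_pi _ _ fun _ => measurePreserving_mul_left μ g

/-- Omitting the `i`-th coordinate. -/
theorem quasiMeasurePreserving_face {G : Type u} [MeasurableSpace G] (μ : Measure G) [SigmaFinite μ]
    (q : ℕ) (i : Fin (q + 1)) :
    Measure.QuasiMeasurePreserving (fun (x : Fin (q + 1) → G) (j : Fin q) => x (i.succAbove j))
      (powMeasure μ (q + 1)) (powMeasure μ q) :=
  Measure.quasiMeasurePreserving_snd.comp
    (measurePreserving_piFinSuccAbove (fun _ : Fin (q + 1) => μ) i).quasiMeasurePreserving

variable {G : Type u} [Group G] [TopologicalSpace G] [IsTopologicalGroup G] [MeasurableSpace G]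
  [BorelSpace G] (μ : Measure G) [SigmaFinite μ] (A : Type v) [AddCommGroup A] [TopologicalSpace A]
  [IsTopologicalAddGroup A]

/-- The diagonal action of `g` on `𝒞(G^q, A)`:
`(g • φ)(g₁, …, g_q) = g • φ(g⁻¹ g₁, …, g⁻¹ g_q)`. -/
noncomputable def act [μ.IsMulLeftInvariant] [DistribMulAction G A] [ContinuousSMul G A] (q : ℕ)
    (g : G) : Cochain μ A q →+ Cochain μ A q where
  toFun φ := AEEqFun.comp (fun a : A => g • a) (continuous_const_smul g)
    (φ.compMeasurePreserving (fun x i => g⁻¹ * x i) (measurePreserving_diag μ q g⁻¹))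
  map_zero' := by
    refine AEEqFun.ext ?_
    refine (AEEqFun.coeFn_comp _ _ _).trans ?_
    have h := AEEqFun.coeFn_compMeasurePreserving (0 : Cochain μ A q)
      (measurePreserving_diag μ q g⁻¹)
    have h0 := (measurePreserving_diag μ q g⁻¹).quasiMeasurePreserving.ae_eq_comp
      (AEEqFun.coeFn_zero (μ := powMeasure μ q) (β := A))
    filter_upwards [h, h0, AEEqFun.coeFn_zero (μ := powMeasure μ q) (β := A)] with x h1 h2 h3
    simp only [Function.comp_apply] at h1 h2 ⊢
    rw [h1, h2, h3]
    simp
  map_add' φ ψ := by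
    refine AEEqFun.ext ?_
    refine (AEEqFun.coeFn_comp _ _ _).trans ?_
    refine EventuallyEq.trans ?_ (AEEqFun.coeFn_add _ _).symm
    have hm := measurePreserving_diag μ q g⁻¹
    filter_upwards [AEEqFun.coeFn_compMeasurePreserving (φ + ψ) hm,
      AEEqFun.coeFn_compMeasurePreserving φ hm, AEEqFun.coeFn_compMeasurePreserving ψ hm,
      hm.quasiMeasurePreserving.ae_eq_comp (AEEqFun.coeFn_add φ ψ),
      AEEqFun.coeFn_comp (fun a : A => g • a) (continuous_const_smul g)
        (φ.compMeasurePreserving _ hm),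
      AEEqFun.coeFn_comp (fun a : A => g • a) (continuous_const_smul g)
        (ψ.compMeasurePreserving _ hm)] with x h1 h2 h3 h4 h5 h6
    simp only [Function.comp_apply, Pi.add_apply] at h1 h2 h3 h4 h5 h6 ⊢
    rw [h5, h6, h1, h2, h3, h4, smul_add]

/-- The subgroup `𝒞(G^q, A)^G` of classes fixed by the diagonal action. -/
noncomputable def invariants [μ.IsMulLeftInvariant] [DistribMulAction G A] [ContinuousSMul G A]
    (q : ℕ) : AddSubgroup (Cochain μ A q) :=
  ⨅ g : G, (act μ A q g).eqLocus (AddMonoidHom.id _)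

/-- The `i`-th face map `𝒞(G^q, A) → 𝒞(G^(q+1), A)`, precomposition with omission of the `i`-th
coordinate. -/
noncomputable def face (q : ℕ) (i : Fin (q + 1)) : Cochain μ A q →+ Cochain μ A (q + 1) where
  toFun σ := σ.compQuasiMeasurePreserving (fun x j => x (i.succAbove j))
    (quasiMeasurePreserving_face μ q i)
  map_zero' := by
    refine AEEqFun.ext ?_
    have hm := quasiMeasurePreserving_face μ q i
    exact (AEEqFun.coeFn_compQuasiMeasurePreserving _ hm).trans
      ((hm.ae_eq_comp AEEqFun.coeFn_zero).trans AEEqFun.coeFn_zero.symm)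
  map_add' σ τ := by
    refine AEEqFun.ext ?_
    refine EventuallyEq.trans ?_ (AEEqFun.coeFn_add _ _).symm
    have hm := quasiMeasurePreserving_face μ q i
    filter_upwards [AEEqFun.coeFn_compQuasiMeasurePreserving (σ + τ) hm,
      AEEqFun.coeFn_compQuasiMeasurePreserving σ hm, AEEqFun.coeFn_compQuasiMeasurePreserving τ hm,
      hm.ae_eq_comp (AEEqFun.coeFn_add σ τ)] with x h1 h2 h3 h4
    simp only [Function.comp_apply, Pi.add_apply] at h1 h2 h3 h4 ⊢
    rw [h1, h2, h3, h4]

/-- The differential `𝒞(G^q, A) → 𝒞(G^(q+1), A)`, the alternating sum of the face maps, with sign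
`+1` at the last one. -/
noncomputable def d (q : ℕ) : Cochain μ A q →+ Cochain μ A (q + 1) :=
  ∑ i : Fin (q + 1), (-1 : ℤ) ^ (q - (i : ℕ)) • face μ A q i

theorem coeFn_face (q : ℕ) (i : Fin (q + 1)) (σ : Cochain μ A q) :
    ⇑(face μ A q i σ) =ᵐ[powMeasure μ (q + 1)] fun x => σ (fun j => x (i.succAbove j)) :=
  AEEqFun.coeFn_compQuasiMeasurePreserving _ (quasiMeasurePreserving_face μ q i)

theorem face_face (q : ℕ) (i : Fin (q + 2)) (j : Fin (q + 1)) (σ : Cochain μ A q) :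
    face μ A (q + 1) i (face μ A q j σ) =
      face μ A (q + 1) (i.succAbove j) (face μ A q (j.predAbove i) σ) := by
  refine AEEqFun.ext ?_
  refine (coeFn_face μ A _ _ _).trans (EventuallyEq.trans ?_ (coeFn_face μ A _ _ _).symm)
  have h1 := (quasiMeasurePreserving_face μ (q + 1) i).ae_eq_comp (coeFn_face μ A q j σ)
  have h2 := (quasiMeasurePreserving_face μ (q + 1) (i.succAbove j)).ae_eq_comp
    (coeFn_face μ A q (j.predAbove i) σ)
  refine h1.trans (EventuallyEq.trans ?_ h2.symm)
  refine Eventually.of_forall fun x => ?_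
  simp only [Function.comp_apply, Fin.succAbove_succAbove_succAbove_predAbove]

theorem d_apply (q : ℕ) (σ : Cochain μ A q) :
    d μ A q σ = ∑ i : Fin (q + 1), (-1 : ℤ) ^ (q - (i : ℕ)) • face μ A q i σ := by
  simp [d]

theorem d_d (q : ℕ) (σ : Cochain μ A q) : d μ A (q + 1) (d μ A q σ) = 0 := by
  simp only [d_apply, map_sum, map_zsmul, Finset.smul_sum, smul_smul]
  rw [Finset.sum_comm, ← Fintype.sum_prod_type' (f := fun (i : Fin (q + 2)) (j : Fin (q + 1)) =>
    ((-1 : ℤ) ^ (q - (j : ℕ)) * (-1) ^ (q + 1 - (i : ℕ))) • face μ A (q + 1) i (face μ A q j σ))]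
  refine Finset.sum_involution (fun ij _ => (ij.1.succAbove ij.2, ij.2.predAbove ij.1)) ?_ ?_ ?_ ?_
  · rintro ⟨i, j⟩ -
    dsimp only
    rw [← face_face, ← add_smul]
    convert zero_smul ℤ _
    have hi := i.2
    have hj := j.2
    rw [← pow_add, ← pow_add]
    rcases lt_or_ge j.castSucc i with h | h
    · rw [Fin.succAbove_of_castSucc_lt _ _ h, Fin.predAbove_of_castSucc_lt _ _ h]
      have h' : (j : ℕ) < i := h
      simp only [Fin.val_castSucc, Fin.val_pred]
      rw [show q - ((i : ℕ) - 1) + (q + 1 - (j : ℕ)) = q - (j : ℕ) + (q + 1 - (i : ℕ)) + 1 by omega,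
        pow_succ]
      ring
    · rw [Fin.succAbove_of_le_castSucc _ _ h, Fin.predAbove_of_le_castSucc _ _ h]
      have h' : (i : ℕ) ≤ j := h
      simp only [Fin.val_succ, Fin.coe_castPred]
      rw [show q - (j : ℕ) + (q + 1 - (i : ℕ)) = q - (i : ℕ) + (q + 1 - ((j : ℕ) + 1)) + 1 by omega,
        pow_succ]
      ring
  · rintro ⟨i, j⟩ - -
    simp [Fin.succAbove_ne]
  · simp
  · rintro ⟨i, j⟩ -
    simp [Fin.succAbove_succAbove_predAbove, Fin.predAbove_predAbove_succAbove]

variable [μ.IsMulLeftInvariant] [DistribMulAction G A] [ContinuousSMul G A]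

theorem coeFn_act (q : ℕ) (g : G) (φ : Cochain μ A q) :
    ⇑(act μ A q g φ) =ᵐ[powMeasure μ q] fun x => g • φ (fun i => g⁻¹ * x i) := by
  refine (AEEqFun.coeFn_comp (fun a : A => g • a) (continuous_const_smul g) _).trans ?_
  filter_upwards [AEEqFun.coeFn_compMeasurePreserving φ (measurePreserving_diag μ q g⁻¹)] with x hx
  exact congrArg (g • ·) hx

theorem mem_invariants (q : ℕ) (φ : Cochain μ A q) :
    φ ∈ invariants μ A q ↔ ∀ g : G, act μ A q g φ = φ := by
  simp only [invariants, AddSubgroup.mem_iInf]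
  exact Iff.rfl

theorem act_face (q : ℕ) (g : G) (i : Fin (q + 1)) (φ : Cochain μ A q) :
    act μ A (q + 1) g (face μ A q i φ) = face μ A q i (act μ A q g φ) := by
  refine AEEqFun.ext ?_
  refine (coeFn_act μ A _ _ _).trans (EventuallyEq.trans ?_ (coeFn_face μ A _ _ _).symm)
  have h1 := (measurePreserving_diag μ (q + 1) g⁻¹).quasiMeasurePreserving.ae_eq_comp
    (coeFn_face μ A q i φ)
  have h2 := (quasiMeasurePreserving_face μ q i).ae_eq_comp (coeFn_act μ A q g φ)
  filter_upwards [h1, h2] with x h1 h2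
  simp only [Function.comp_apply] at h1 h2
  rw [h1, h2]

/-- The cocycles of degree `p`: the kernel of `d` on `𝒞(G^(p+1), A)^G`. -/
noncomputable def cocycles (p : ℕ) : AddSubgroup (Cochain μ A (p + 1)) :=
  invariants μ A (p + 1) ⊓ (d μ A (p + 1)).ker

/-- The coboundaries of degree `p`: the image of `d` on `𝒞(G^p, A)^G` for `p ≥ 1`, and `0` for
`p = 0`, where the complex `𝒞(G, A)^G → 𝒞(G², A)^G → ⋯` begins. -/
noncomputable def coboundaries : (p : ℕ) → AddSubgroup (Cochain μ A (p + 1))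
  | 0 => ⊥
  | p + 1 => (invariants μ A (p + 1)).map (d μ A (p + 1))

/-- The coboundaries are cocycles. -/
theorem coboundaries_le_cocycles (p : ℕ) : coboundaries μ A p ≤ cocycles μ A p := by
  cases p with
  | zero => exact bot_le
  | succ p =>
    rintro _ ⟨φ, hφ, rfl⟩
    refine ⟨(mem_invariants μ A _ _).2 fun g => ?_, d_d μ A _ _⟩
    have h := (mem_invariants μ A _ _).1 hφ g
    simp only [d_apply, map_sum, map_zsmul, act_face, h]

/-- Moore's measurable cohomology group `H^p_m(G, A)`. -/
abbrev Hm (p : ℕ) : Type (max u v) :=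
  cocycles μ A p ⧸ (coboundaries μ A p).addSubgroupOf (cocycles μ A p)

variable {A}

/-- The everywhere defined function `σ : G^(p+1) → A` is a homogeneous cocycle (`G`-equivariant and
in the kernel of the alternating-sum differential), and its a.e. class is measurable and lies in
the cohomology class `c`. -/
structure Represents {p : ℕ} (c : Hm μ A p) (σ : (Fin (p + 1) → G) → A) : Prop where
  equivariant : ∀ (g : G) (x : Fin (p + 1) → G), σ (fun i => g * x i) = g • σ x
  cocycle : ∀ x : Fin (p + 2) → G,
    ∑ i : Fin (p + 2), (-1 : ℤ) ^ (p + 1 - (i : ℕ)) • σ (fun j => x (i.succAbove j)) = 0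
  mem_class : ∃ z : cocycles μ A p,
    (QuotientAddGroup.mk z : Hm μ A p) = c ∧ ⇑(z : Cochain μ A (p + 1)) =ᵐ[powMeasure μ (p + 1)] σ

end MooreCohomology

/-! ### Regularity of functions -/

/-- Every point has a neighbourhood on which `f` takes only finitely many values. -/
def LocallyFiniteValued {X A : Type*} [TopologicalSpace X] (f : X → A) : Prop :=
  ∀ x : X, ∃ U ∈ 𝓝 x, (f '' U).Finite

/-- `f` is locally constant on some dense open set whose complement is null. -/
def LocallyConstantOnFullDenseOpen {X A : Type*} [TopologicalSpace X] [MeasurableSpace X]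
    (ν : Measure X) (f : X → A) : Prop :=
  ∃ U : Set X, IsOpen U ∧ Dense U ∧ ν Uᶜ = 0 ∧ ∀ x ∈ U, ∀ᶠ y in 𝓝 x, f y = f x

/-! ### Semi-algebraic sets and algebraic matrix groups -/

/-- The semi-algebraic subsets of the affine space `ℝ^ι`: the smallest class that contains all sets
`{x | f x > 0}`, `f` a polynomial, and is closed under complements and finite intersections
(hence also under finite unions). -/
inductive IsSemialgebraic {ι : Type*} : Set (ι → ℝ) → Prop
  | pos (f : MvPolynomial ι ℝ) : IsSemialgebraic {x | 0 < MvPolynomial.eval x f}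
  | compl {S : Set (ι → ℝ)} : IsSemialgebraic S → IsSemialgebraic Sᶜ
  | inter {S T : Set (ι → ℝ)} : IsSemialgebraic S → IsSemialgebraic T → IsSemialgebraic (S ∩ T)

/-- A subgroup of `GL_n(ℝ)` is algebraic if it is the set of invertible matrices at which all the
polynomials of some set, in the `n²` matrix entries, vanish. -/
def IsAlgebraicSubgroup {n : ℕ} (H : Subgroup (GL (Fin n) ℝ)) : Prop :=
  ∃ S : Set (MvPolynomial (Fin n × Fin n) ℝ),
    ∀ g : GL (Fin n) ℝ, g ∈ H ↔
      ∀ f ∈ S, MvPolynomial.eval (fun k => (g : Matrix (Fin n) (Fin n) ℝ) k.1 k.2) f = 0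

/-- The coordinates of a `q`-tuple of elements of a matrix group `ρ : G → GL_n(ℝ)`, as a point of the
affine space `M_{n×n}(ℝ)^q` of `q`-tuples of matrices. -/
def matrixCoords {G : Type*} [Group G] {n : ℕ} (ρ : G →* GL (Fin n) ℝ) (q : ℕ) (x : Fin q → G) :
    Fin q × Fin n × Fin n → ℝ :=
  fun k => (ρ (x k.1) : Matrix (Fin n) (Fin n) ℝ) k.2.1 k.2.2

/-- `f` is constant on every cell of some locally finite partition of `G^q` into sets that are
semi-algebraic in the space of `q`-tuples of matrices. -/
def IsSemialgebraicallyPartitioned {G : Type*} [Group G] [TopologicalSpace G] {A : Type*} {n : ℕ}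
    (ρ : G →* GL (Fin n) ℝ) {q : ℕ} (f : (Fin q → G) → A) : Prop :=
  ∃ P : Set (Set (Fin q → G)), Setoid.IsPartition P ∧
    LocallyFinite (Subtype.val : P → Set (Fin q → G)) ∧
    (∀ C ∈ P, IsSemialgebraic (matrixCoords ρ q '' C)) ∧
    ∀ C ∈ P, ∀ x ∈ C, ∀ y ∈ C, f x = f y

/-! A function `φ (x, y)` on `G^a × G^b` that is tame in `x` (up to small sets of `y`, constant on
the cells of a locally finite partition into sets with null frontier) and merely measurable in `y`
interpolates between the measurable cocycles (`a = 0`) and the regular ones (`b = 0`). A measurable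
cocycle on `G^b` has a measurable primitive, obtained by fixing its first variable. For a family
which is tame in `x` such primitives can be chosen tame in `x`: by continuity in measure the family
differs only on small sets from a locally constant one, and the errors are summed by Borel–Cantelli.
Choosing the primitives on the tuples starting with `1` and translating them makes them equivariant.
The coboundary of a primitive in its `x` variables is then a cocycle with one variable moved from
`y` to `x`. Restricted to the tuples whose last `x` variable is the first `y` variable, all these
functions are cohomologous; a generic right translation gives the restriction to this null set a
meaning. All this needs a countable module, such as the submodule generated by the values of a given
cocycle. -/

/-! ### Locally finite-valued functions -/

namespace LocallyFiniteValued

variable {X X' A B C : Type*} [TopologicalSpace X] [TopologicalSpace X']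

theorem const (a : A) : LocallyFiniteValued fun _ : X => a := fun _ =>
  ⟨Set.univ, univ_mem, (Set.finite_singleton a).subset (Set.image_subset_iff.2 fun _ _ => rfl)⟩

theorem comp {f : X → A} (hf : LocallyFiniteValued f) {g : X' → X} (hg : Continuous g) :
    LocallyFiniteValued (f ∘ g) := fun x =>
  let ⟨U, hU, hfU⟩ := hf (g x)
  ⟨g ⁻¹' U, hg.continuousAt hU, hfU.subset <| by
    rw [Set.image_comp]; exact Set.image_mono (Set.image_preimage_subset g U)⟩

theorem map₂ {f : X → A} {g : X → B} (hf : LocallyFiniteValued f) (hg : LocallyFiniteValued g)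
    (m : A → B → C) : LocallyFiniteValued fun x => m (f x) (g x) := fun x =>
  let ⟨U, hU, hfU⟩ := hf x
  let ⟨V, hV, hgV⟩ := hg x
  ⟨U ∩ V, inter_mem hU hV, (hfU.image2 m hgV).subset <| Set.image_subset_iff.2 fun _ hy =>
    Set.mem_image2_of_mem (Set.mem_image_of_mem f hy.1) (Set.mem_image_of_mem g hy.2)⟩

theorem of_factorsThrough {f : X → A} (hf : LocallyFiniteValued f) {g : X → B}
    (h : g.FactorsThrough f) : LocallyFiniteValued g := fun x =>
  let ⟨U, hU, hfU⟩ := hf x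
  ⟨U, hU, (hfU.image (Function.extend f g fun _ => g x)).subset <|
    Set.image_subset_iff.2 fun y hy => ⟨f y, Set.mem_image_of_mem f hy, h.extend_apply _ y⟩⟩

end LocallyFiniteValued

namespace MooreCohomology

open scoped ENNReal

/-! ### Labellings and tame families -/

/-- An algebra of subsets of `X` whose open members form a basis of the topology. -/
structure IsTopologicalSetAlgebra {X : Type*} [TopologicalSpace X] (𝒩 : Set (Set X)) : Prop
    extends IsSetAlgebra 𝒩 where
  exists_isOpen_subset : ∀ x, ∀ U ∈ 𝓝 x, ∃ W ∈ 𝒩, IsOpen W ∧ x ∈ W ∧ W ⊆ U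

/-- A labelling of the points of `X` by natural numbers: it encodes a locally finite partition of
`X` into members of `𝒩`, one of which is a neighbourhood of the base point `x₀`. -/
structure IsLabel {X : Type*} [TopologicalSpace X] (𝒩 : Set (Set X)) (x₀ : X) (N : X → ℕ) :
    Prop where
  preimage_mem : ∀ n, N ⁻¹' {n} ∈ 𝒩
  locallyFiniteValued : LocallyFiniteValued N
  eventually_eq : ∀ᶠ y in 𝓝 x₀, N y = N x₀

section Labels

variable {X X' : Type*} [TopologicalSpace X] [TopologicalSpace X'] {𝒩 : Set (Set X)} {x₀ : X}

theorem IsLabel.measurable [MeasurableSpace X] (h : ∀ C ∈ 𝒩, MeasurableSet C) {N : X → ℕ}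
    (hN : IsLabel 𝒩 x₀ N) : Measurable N :=
  measurable_to_countable' fun n => h _ (hN.preimage_mem n)

theorem IsLabel.const (h𝒩 : IsSetAlgebra 𝒩) (x₀ : X) (n : ℕ) : IsLabel 𝒩 x₀ fun _ => n where
  preimage_mem m := by
    by_cases h : n = m
    · simpa [Set.preimage_const, h] using h𝒩.univ_mem
    · simpa [Set.preimage_const, h] using h𝒩.empty_mem
  locallyFiniteValued := .const n
  eventually_eq := by simp

theorem preimage_pair_eq_inter {α : Type*} (N N' : α → ℕ) (n : ℕ) :
    (fun x => Nat.pair (N x) (N' x)) ⁻¹' {n} = N ⁻¹' {n.unpair.1} ∩ N' ⁻¹' {n.unpair.2} := by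
  ext x
  simp only [Set.mem_preimage, Set.mem_singleton_iff, Set.mem_inter_iff]
  rw [← Nat.pair_unpair n, Nat.pair_eq_pair, Nat.pair_unpair]

theorem IsLabel.pair (h𝒩 : IsSetAlgebra 𝒩) {N N' : X → ℕ} (h : IsLabel 𝒩 x₀ N)
    (h' : IsLabel 𝒩 x₀ N') : IsLabel 𝒩 x₀ fun x => Nat.pair (N x) (N' x) where
  preimage_mem n :=
    preimage_pair_eq_inter N N' n ▸ h𝒩.inter_mem (h.preimage_mem _) (h'.preimage_mem _)
  locallyFiniteValued := h.locallyFiniteValued.map₂ h'.locallyFiniteValued Nat.pair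
  eventually_eq := by
    filter_upwards [h.eventually_eq, h'.eventually_eq] with y h1 h2
    rw [h1, h2]

theorem IsLabel.comp {N : X → ℕ} (h : IsLabel 𝒩 x₀ N) {𝒩' : Set (Set X')} {x₀' : X'} {f : X' → X}
    (hf : Continuous f) (hm : ∀ C ∈ 𝒩, f ⁻¹' C ∈ 𝒩') (h0 : f x₀' = x₀) :
    IsLabel 𝒩' x₀' (N ∘ f) where
  preimage_mem n := hm _ (h.preimage_mem n)
  locallyFiniteValued := h.locallyFiniteValued.comp hf
  eventually_eq := by
    subst h0
    exact hf.continuousAt.eventually h.eventually_eq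

/-- Labellings of the members of a countable open cover are glued by recording the index of the
first member that contains a given point, and the label there. -/
theorem exists_isLabel_of_cover (h𝒩 : IsSetAlgebra 𝒩) {W : ℕ → Set X} (hW : ∀ n, W n ∈ 𝒩)
    (hWo : ∀ n, IsOpen (W n)) (hcov : ∀ x, ∃ n, x ∈ W n) (h₀ : x₀ ∈ W 0) {N : ℕ → X → ℕ}
    (hN : ∀ n, IsLabel 𝒩 x₀ (N n)) :
    ∃ L, IsLabel 𝒩 x₀ L ∧
      ∀ x x', L x = L x' → ∃ n, x ∈ W n ∧ x' ∈ W n ∧ N n x = N n x' := by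
  classical
  let i : X → ℕ := fun x => Nat.find (hcov x)
  have hi : ∀ x, x ∈ W (i x) := fun x => Nat.find_spec (hcov x)
  have hi_le : ∀ n, ∀ x ∈ W n, i x ≤ n := fun n x h => Nat.find_min' (hcov x) h
  refine ⟨fun x => Nat.pair (i x) (N (i x) x), ⟨fun n => ?_, fun x => ?_, ?_⟩, fun x x' h => ?_⟩
  · have : (fun x => Nat.pair (i x) (N (i x) x)) ⁻¹' {n} =
        disjointed W n.unpair.1 ∩ N n.unpair.1 ⁻¹' {n.unpair.2} := by
      rw [← preimage_find_eq_disjointed W hcov, preimage_pair_eq_inter i fun x => N (i x) x]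
      exact Set.ext fun x => and_congr_right fun (hx : i x = _) => by
        simp only [Set.mem_preimage, hx]
    rw [this]
    exact h𝒩.inter_mem (h𝒩.isSetRing.disjointed_mem hW _) ((hN _).preimage_mem _)
  · choose U hU hNU using fun j => (hN j).locallyFiniteValued x
    refine ⟨(⋂ j ∈ Finset.Iic (i x), U j) ∩ W (i x),
      inter_mem ((biInter_finset_mem _).2 fun j _ => hU j) ((hWo _).mem_nhds (hi x)),
      ((Finset.Iic (i x)).finite_toSet.biUnion fun j _ =>
        (hNU j).image (Nat.pair j)).subset ?_⟩
    rintro _ ⟨y, ⟨hyU, hyW⟩, rfl⟩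
    have hy : i y ∈ Finset.Iic (i x) := Finset.mem_Iic.2 (hi_le _ y hyW)
    exact Set.mem_biUnion hy ⟨_, Set.mem_image_of_mem _ (Set.mem_iInter₂.1 hyU _ hy), rfl⟩
  · have hi0 : ∀ y ∈ W 0, i y = 0 := fun y hy => Nat.le_zero.1 (hi_le 0 y hy)
    filter_upwards [(hWo 0).mem_nhds h₀, (hN 0).eventually_eq] with y hy hNy
    rw [hi0 y hy, hi0 x₀ h₀, hNy]
  · obtain ⟨h1, h2⟩ := Nat.pair_eq_pair.1 h
    exact ⟨i x, hi x, h1 ▸ hi x', by rw [h2, h1]⟩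

theorem exists_isLabel_of_local [SecondCountableTopology X] (h𝒩 : IsTopologicalSetAlgebra 𝒩)
    (x₀ : X) {R : X → X → Prop}
    (H : ∀ x, ∃ U ∈ 𝓝 x, ∃ N, IsLabel 𝒩 x₀ N ∧ ∀ z ∈ U, ∀ z' ∈ U, N z = N z' → R z z') :
    ∃ N, IsLabel 𝒩 x₀ N ∧ ∀ z z', N z = N z' → R z z' := by
  choose U hU N hN hR using H
  choose W hW hWo hxW hWU using fun x => h𝒩.exists_isOpen_subset x (U x) (hU x)
  obtain ⟨s, hs, hsW⟩ :=
    TopologicalSpace.countable_cover_nhds fun x => (hWo x).mem_nhds (hxW x)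
  obtain ⟨e, he⟩ := (hs.insert x₀).exists_eq_range (Set.insert_nonempty _ _)
  -- The base point comes first in the sequence of centres, so that `L` is constant near it.
  let c : ℕ → X := fun n => Nat.casesOn n x₀ e
  have hcov : ∀ x, ∃ n, x ∈ W (c n) := fun x => by
    obtain ⟨i, hi, hx⟩ := Set.mem_iUnion₂.1 (hsW.ge (Set.mem_univ x))
    obtain ⟨n, rfl⟩ := he.le (Set.mem_insert_of_mem x₀ hi)
    exact ⟨n + 1, hx⟩
  obtain ⟨L, hL, hLN⟩ := exists_isLabel_of_cover h𝒩.toIsSetAlgebra (fun n => hW (c n))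
    (fun n => hWo (c n)) hcov (hxW x₀) fun n => hN (c n)
  refine ⟨L, hL, fun z z' h => ?_⟩
  obtain ⟨n, hz, hz', hNz⟩ := hLN z z' h
  exact hR (c n) z (hWU _ hz) z' (hWU _ hz') hNz

end Labels

theorem measure_ne_le_add {Y B : Type*} [MeasurableSpace Y] (ν : Measure Y) (f g h : Y → B) :
    ν {y | f y ≠ h y} ≤ ν {y | f y ≠ g y} + ν {y | g y ≠ h y} := by
  refine (measure_mono fun y hy => ?_).trans (measure_union_le _ _)
  by_contra hcon
  simp only [Set.mem_union, Set.mem_ofPred_eq, not_or, not_not] at hcon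
  exact hy (hcon.1.trans hcon.2)

/-- The family `φ` of functions on `Y`, indexed by `X`, is constant on the level sets of
labellings, up to sets of arbitrarily small measure `ν`. It is the substitute, for the variables
in `X`, of measurability. -/
def IsTame {X Y B : Type*} [TopologicalSpace X] [MeasurableSpace Y] (𝒩 : Set (Set X)) (x₀ : X)
    (ν : Measure Y) (φ : X → Y → B) : Prop :=
  ∀ ε : ℝ≥0∞, ε ≠ 0 → ∃ N, IsLabel 𝒩 x₀ N ∧ ∀ x x', N x = N x' → ν {y | φ x y ≠ φ x' y} ≤ ε

namespace IsTame

variable {X X' Y B : Type*} [TopologicalSpace X] [TopologicalSpace X'] [MeasurableSpace Y]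
  {𝒩 : Set (Set X)} {x₀ : X} {ν : Measure Y} {φ ψ : X → Y → B}

theorem const (h𝒩 : IsSetAlgebra 𝒩) (c : Y → B) : IsTame 𝒩 x₀ ν fun _ => c :=
  fun _ _ => ⟨_, IsLabel.const h𝒩 x₀ 0, by simp⟩

theorem comp (h : IsTame 𝒩 x₀ ν φ) {𝒩' : Set (Set X')} {x₀' : X'} {f : X' → X}
    (hf : Continuous f) (hm : ∀ C ∈ 𝒩, f ⁻¹' C ∈ 𝒩') (h0 : f x₀' = x₀) :
    IsTame 𝒩' x₀' ν fun x => φ (f x) := fun ε hε =>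
  let ⟨N, hN, hφ⟩ := h ε hε
  ⟨N ∘ f, hN.comp hf hm h0, fun _ _ => hφ _ _⟩

variable [AddCommGroup B]

theorem add (h𝒩 : IsSetAlgebra 𝒩) (hφ : IsTame 𝒩 x₀ ν φ) (hψ : IsTame 𝒩 x₀ ν ψ) :
    IsTame 𝒩 x₀ ν fun x y => φ x y + ψ x y := by
  intro ε hε
  obtain ⟨N, hN, h⟩ := hφ (ε / 2) (by simpa using hε)
  obtain ⟨N', hN', h'⟩ := hψ (ε / 2) (by simpa using hε)
  refine ⟨_, hN.pair h𝒩 hN', fun x x' hx => ?_⟩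
  obtain ⟨h1, h2⟩ := Nat.pair_eq_pair.1 hx
  calc ν {y | φ x y + ψ x y ≠ φ x' y + ψ x' y}
      ≤ ν {y | φ x y + ψ x y ≠ φ x' y + ψ x y} + ν {y | φ x' y + ψ x y ≠ φ x' y + ψ x' y} :=
        measure_ne_le_add ν _ _ _
    _ = ν {y | φ x y ≠ φ x' y} + ν {y | ψ x y ≠ ψ x' y} := by
        simp only [ne_eq, add_left_inj, add_right_inj]
    _ ≤ ε / 2 + ε / 2 := add_le_add (h _ _ h1) (h' _ _ h2)
    _ = ε := ENNReal.add_halves ε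

theorem zsmul (hφ : IsTame 𝒩 x₀ ν φ) (n : ℤ) : IsTame 𝒩 x₀ ν fun x y => n • φ x y := by
  intro ε hε
  obtain ⟨N, hN, h⟩ := hφ ε hε
  exact ⟨N, hN, fun x x' hx =>
    (measure_mono fun y => mt fun e : φ x y = φ x' y => congrArg (n • ·) e).trans (h x x' hx)⟩

theorem sum (h𝒩 : IsSetAlgebra 𝒩) {ι : Type*} {s : Finset ι} {φ : ι → X → Y → B}
    (hφ : ∀ i ∈ s, IsTame 𝒩 x₀ ν (φ i)) : IsTame 𝒩 x₀ ν fun x y => ∑ i ∈ s, φ i x y := by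
  classical
  induction s using Finset.induction_on with
  | empty => simpa using const h𝒩 fun _ => (0 : B)
  | insert a s ha ih =>
    simp only [Finset.sum_insert ha]
    exact (hφ _ (Finset.mem_insert_self _ _)).add h𝒩
      (ih fun i hi => hφ i (Finset.mem_insert_of_mem hi))

end IsTame

theorem IsTame.exists_seq_isLabel {X Y B : Type*} [TopologicalSpace X] [MeasurableSpace Y]
    {𝒩 : Set (Set X)} {x₀ : X} {ν : Measure Y} {φ : X → Y → B} (h𝒩 : IsSetAlgebra 𝒩)
    (h : IsTame 𝒩 x₀ ν φ) :
    ∃ N : ℕ → X → ℕ, (∀ n, IsLabel 𝒩 x₀ (N n)) ∧ (∀ n, (N n).FactorsThrough (N (n + 1))) ∧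
      ∀ n x x', N n x = N n x' → ν {y | φ x y ≠ φ x' y} ≤ 2⁻¹ ^ n := by
  choose M hM hMφ using fun n : ℕ => h (2⁻¹ ^ n) (by simp)
  let N : ℕ → X → ℕ := fun n => Nat.rec (M 0) (fun n L x => Nat.pair (L x) (M (n + 1) x)) n
  refine ⟨N, fun n => ?_, fun n x x' hx => (Nat.pair_eq_pair.1 hx).1, fun n x x' hx => ?_⟩
  · induction n with
    | zero => exact hM 0
    | succ n ih => exact ih.pair h𝒩 (hM (n + 1))
  · cases n with
    | zero => exact hMφ 0 x x' hx
    | succ n => exact hMφ (n + 1) x x' (Nat.pair_eq_pair.1 hx).2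

/-! ### The alternating sum of the faces -/

/-- The alternating sum of the faces of an everywhere defined function, with sign `+1` at the first
one. On `G^n` it differs from the differential of the complex by the sign `(-1)^n`. -/
def coboundary {α B : Type*} [AddCommGroup B] {n : ℕ} (f : (Fin n → α) → B)
    (y : Fin (n + 1) → α) : B :=
  ∑ i : Fin (n + 1), (-1 : ℤ) ^ (i : ℕ) • f (i.removeNth y)

section Coboundary

variable {α B : Type*} [AddCommGroup B] {n : ℕ}

theorem coboundary_add (f g : (Fin n → α) → B) (y : Fin (n + 1) → α) :
    coboundary (fun x => f x + g x) y = coboundary f y + coboundary g y := by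
  simp [coboundary, Finset.sum_add_distrib]

theorem coboundary_zsmul (k : ℤ) (f : (Fin n → α) → B) (y : Fin (n + 1) → α) :
    coboundary (fun x => k • f x) y = k • coboundary f y := by
  simp only [coboundary, Finset.smul_sum, smul_comm k]

theorem coboundary_sub (f g : (Fin n → α) → B) (y : Fin (n + 1) → α) :
    coboundary (fun x => f x - g x) y = coboundary f y - coboundary g y := by
  simp [coboundary, smul_sub, Finset.sum_sub_distrib]

theorem coboundary_congr {f g : (Fin n → α) → B} {y : Fin (n + 1) → α}
    (h : ∀ i : Fin (n + 1), f (i.removeNth y) = g (i.removeNth y)) :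
    coboundary f y = coboundary g y :=
  Finset.sum_congr rfl fun i _ => by rw [h i]

theorem coboundary_cons (c : (Fin (n + 1) → α) → B) (h : α) (y : Fin (n + 1) → α) :
    coboundary c (Fin.cons h y) = c y - coboundary (fun w => c (Fin.cons h w)) y := by
  have hface (i : Fin (n + 1)) :
      i.succ.removeNth (Fin.cons h y : Fin (n + 2) → α) = Fin.cons h (i.removeNth y) :=
    Fin.cons_comp_succ_succAbove h y i
  rw [coboundary, Fin.sum_univ_succ, sub_eq_add_neg, coboundary, ← Finset.sum_neg_distrib]
  simp [hface, pow_succ]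

theorem coboundary_coboundary (f : (Fin n → α) → B) (y : Fin (n + 2) → α) :
    coboundary (coboundary f) y = 0 := by
  simp only [coboundary, Finset.smul_sum, smul_smul, ← pow_add]
  rw [← Fintype.sum_prod_type' (f := fun (i : Fin (n + 2)) (j : Fin (n + 1)) =>
    (-1 : ℤ) ^ (i + j : ℕ) • f (j.removeNth (i.removeNth y)))]
  refine Finset.sum_involution (fun ij _ => (ij.1.succAbove ij.2, ij.2.predAbove ij.1)) ?_ ?_ ?_ ?_
  · rintro ⟨i, j⟩ -
    dsimp only
    rw [Fin.neg_one_pow_succAbove_add_predAbove, Fin.removeNth_removeNth_eq_swap, neg_smul,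
      add_neg_cancel]
  · rintro ⟨i, j⟩ - -
    simp [Fin.succAbove_ne]
  · simp
  · rintro ⟨i, j⟩ -
    simp [Fin.succAbove_succAbove_predAbove, Fin.predAbove_predAbove_succAbove]

theorem coboundary_comm {β : Type*} {m : ℕ} (f : (Fin m → α) → (Fin n → β) → B)
    (x : Fin (m + 1) → α) (y : Fin (n + 1) → β) :
    coboundary (fun y => coboundary (fun x => f x y) x) y =
      coboundary (fun x => coboundary (f x) y) x := by
  simp only [coboundary, Finset.smul_sum]
  rw [Finset.sum_comm]
  exact Finset.sum_congr rfl fun i _ => Finset.sum_congr rfl fun j _ => smul_comm _ _ _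

theorem measurable_coboundary {Z : Type*} [MeasurableSpace Z] [MeasurableSpace B] [Countable B]
    [DiscreteMeasurableSpace B] {f : Z → (Fin n → α) → B} {y : Z → Fin (n + 1) → α}
    (h : ∀ i : Fin (n + 1), Measurable fun z => f z (i.removeNth (y z))) :
    Measurable fun z => coboundary (f z) (y z) :=
  Finset.measurable_sum _ fun i _ => (measurable_of_countable fun b : B => _ • b).comp (h i)

end Coboundary

/-! ### Eventually constant sequences of measurable functions -/

section EventuallyConstant

variable {Z B : Type*} [MeasurableSpace Z]

theorem exists_measurable_of_eventually_eq [Countable B] [Nonempty B] [MeasurableSpace B]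
    [DiscreteMeasurableSpace B] {s : ℕ → Z → B} (hs : ∀ n, Measurable (s n)) :
    ∃ f : Z → B, Measurable f ∧ ∀ z b, (∀ᶠ n in atTop, s n z = b) → f z = b := by
  let _ : TopologicalSpace B := ⊥
  have : DiscreteTopology B := ⟨rfl⟩
  have : BorelSpace B := ⟨by
    rw [borel_eq_top_of_discrete, eq_top_iff]; exact fun s _ => MeasurableSet.of_discrete⟩
  exact ⟨fun z => limUnder atTop (s · z),
    (StronglyMeasurable.limUnder fun n => (hs n).stronglyMeasurable).measurable,
    fun z b h => (tendsto_pure.2 h).mono_right (pure_le_nhds b) |>.limUnder_eq⟩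

variable {ν : Measure Z} {s : ℕ → Z → B}

theorem ae_eventually_notMem_of_le_two_inv_pow {E : ℕ → Set Z} (h : ∀ n, ν (E n) ≤ 2⁻¹ ^ n) :
    ∀ᵐ z ∂ν, ∀ᶠ n in atTop, z ∉ E n :=
  ae_eventually_notMem <| ne_top_of_le_ne_top
    (ENNReal.tsum_geometric_two.trans_ne ENNReal.ofNat_ne_top) (ENNReal.tsum_le_tsum h)

theorem ae_eventually_eq_of_measure_ne_le {f : Z → B} (h : ∀ n, ν {z | s n z ≠ f z} ≤ 2⁻¹ ^ n) :
    ∀ᵐ z ∂ν, ∀ᶠ n in atTop, s n z = f z := by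
  filter_upwards [ae_eventually_notMem_of_le_two_inv_pow h] with z hz
  filter_upwards [hz] with n hn using not_not.1 hn

theorem ae_exists_eventually_eq (h : ∀ n, ν {z | s (n + 1) z ≠ s n z} ≤ 2⁻¹ ^ n) :
    ∀ᵐ z ∂ν, ∃ b, ∀ᶠ n in atTop, s n z = b := by
  filter_upwards [ae_eventually_notMem_of_le_two_inv_pow h] with z hz
  obtain ⟨k, hk⟩ := eventually_atTop.1 hz
  refine ⟨s k z, eventually_atTop.2 ⟨k, fun n hn => ?_⟩⟩
  induction n, hn using Nat.le_induction with
  | base => rfl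
  | succ n hn ih => exact (not_not.1 (hk n hn)).trans ih

theorem measure_ne_le_of_eventually_eq {f : Z → B}
    (h : ∀ n, ν {z | s (n + 1) z ≠ s n z} ≤ 2⁻¹ ^ n) (hf : ∀ᵐ z ∂ν, ∀ᶠ n in atTop, s n z = f z)
    (n : ℕ) : ν {z | s n z ≠ f z} ≤ 2 * 2⁻¹ ^ n := by
  have hsub : {z | s n z ≠ f z} ≤ᵐ[ν] ⋃ m, {z | s (n + m + 1) z ≠ s (n + m) z} := by
    filter_upwards [hf] with z hz hne
    refine Set.mem_iUnion.2 (not_forall_not.1 fun hcon => ?_)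
    have hconst : ∀ m, s (n + m) z = s n z := fun m => by
      induction m with
      | zero => rfl
      | succ m ih => exact (not_not.1 (hcon m)).trans ih
    obtain ⟨k, hk, hnk⟩ := (hz.and (eventually_ge_atTop n)).exists
    exact hne (by rw [← hk, ← hconst (k - n), Nat.add_sub_cancel' hnk])
  calc ν {z | s n z ≠ f z}
      ≤ ∑' m, ν {z | s (n + m + 1) z ≠ s (n + m) z} :=
        (measure_mono_ae hsub).trans (measure_iUnion_le _)
    _ ≤ ∑' m, 2⁻¹ ^ n * 2⁻¹ ^ m :=
        ENNReal.tsum_le_tsum fun m => (h (n + m)).trans_eq (pow_add _ _ _)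
    _ = 2 * 2⁻¹ ^ n := by
        rw [ENNReal.tsum_mul_left, ENNReal.tsum_geometric_two, mul_comm]

theorem measurable_uncurry_of_factorsThrough {X : Type*} [MeasurableSpace X] [MeasurableSpace B]
    {g : X → Z → B} (hg : ∀ x, Measurable (g x)) {N : X → ℕ} (hN : Measurable N)
    (h : g.FactorsThrough N) : Measurable (Function.uncurry g) := by
  cases isEmpty_or_nonempty X
  · exact Measurable.of_discrete
  let g' : ℕ × Z → B := fun p => g (Function.invFun N p.1) p.2
  have hg' : Measurable g' := measurable_from_prod_countable_right fun n => hg (Function.invFun N n)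
  have : Function.uncurry g = g' ∘ Prod.map N id :=
    funext fun p => congrFun (h (Function.invFun_eq ⟨p.1, rfl⟩).symm) p.2
  exact this ▸ hg'.comp (hN.prodMap measurable_id)

end EventuallyConstant

/-! ### Primitives of cocycles -/

section Primitive

variable {G : Type*} [MeasurableSpace G] (μ : Measure G)

theorem powMeasure_absolutelyContinuous [SigmaFinite μ] {ν : Measure G} [SigmaFinite ν]
    (h : μ ≪ ν) (b : ℕ) : powMeasure μ b ≪ powMeasure ν b := by
  induction b with
  | zero => rw [powMeasure, powMeasure, Measure.pi_of_empty, Measure.pi_of_empty]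
  | succ b ih =>
    rw [powMeasure, powMeasure,
      ← (measurePreserving_piFinSuccAbove (fun _ : Fin (b + 1) => μ) 0).symm.map_eq,
      ← (measurePreserving_piFinSuccAbove (fun _ : Fin (b + 1) => ν) 0).symm.map_eq]
    exact (h.prod ih).map (MeasurableEquiv.measurable _)

theorem measurePreserving_cons [SigmaFinite μ] (b : ℕ) :
    MeasurePreserving (fun z : G × (Fin b → G) => (Fin.cons z.1 z.2 : Fin (b + 1) → G))
      (μ.prod (powMeasure μ b)) (powMeasure μ (b + 1)) := by
  convert (measurePreserving_piFinSuccAbove (fun _ : Fin (b + 1) => μ) 0).symm using 1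
  exact funext fun z => (Fin.insertNth_zero' z.1 z.2).symm

theorem ae_removeNth [SigmaFinite μ] {b : ℕ} {P : (Fin b → G) → Prop}
    (h : ∀ᵐ w ∂powMeasure μ b, P w) :
    ∀ᵐ y ∂powMeasure μ (b + 1), ∀ i : Fin (b + 1), P (i.removeNth y) :=
  ae_all_iff.2 fun i => (quasiMeasurePreserving_face μ b i).ae h

theorem coboundary_ae_congr [SigmaFinite μ] {B : Type*} [AddCommGroup B] {b : ℕ}
    {f g : (Fin b → G) → B} (h : f =ᵐ[powMeasure μ b] g) :
    coboundary f =ᵐ[powMeasure μ (b + 1)] coboundary g :=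
  (ae_removeNth μ h).mono fun _ => coboundary_congr

theorem coboundary_coboundary_ae_eq_zero {α B : Type*} [AddCommGroup B] {n b : ℕ}
    {φ : (Fin n → α) → (Fin (b + 1) → G) → B} {τ : (Fin n → α) → (Fin b → G) → B}
    (h0 : ∀ x y, coboundary (fun x => φ x y) x = 0)
    (H : ∀ x, coboundary (τ x) =ᵐ[powMeasure μ (b + 1)] φ x) (x : Fin (n + 1) → α) :
    coboundary (fun y => coboundary (fun x => τ x y) x) =ᵐ[powMeasure μ (b + 1)] 0 := by
  filter_upwards [ae_all_iff.2 fun i : Fin (n + 1) => H (i.removeNth x)] with y hy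
  rw [coboundary_comm, Pi.zero_apply, ← h0 x y]
  exact coboundary_congr hy

variable [IsProbabilityMeasure μ] {B : Type*} [AddCommGroup B] [MeasurableSpace B]
  [DiscreteMeasurableSpace B]

/-- The primitive is a section `c (h, ·)` of the cocycle, at an `h` for which the measure of its
support is at most the average. -/
theorem exists_coboundary_ae_eq {b : ℕ} {c : (Fin (b + 1) → G) → B} (hc : Measurable c)
    (h0 : coboundary c =ᵐ[powMeasure μ (b + 2)] 0) :
    ∃ e : (Fin b → G) → B, Measurable e ∧ coboundary e =ᵐ[powMeasure μ (b + 1)] c ∧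
      powMeasure μ b {w | e w ≠ 0} ≤ powMeasure μ (b + 1) {y | c y ≠ 0} := by
  have hcons := measurePreserving_cons μ b
  have hcocycle : ∀ᵐ h ∂μ, ∀ᵐ y ∂powMeasure μ (b + 1), coboundary c (Fin.cons h y) = 0 :=
    Measure.ae_ae_of_ae_prod ((measurePreserving_cons μ (b + 1)).quasiMeasurePreserving.ae h0)
  have hS : MeasurableSet {y | c y ≠ 0} := (hc (measurableSet_singleton 0)).compl
  have hfubini : powMeasure μ (b + 1) {y | c y ≠ 0} =
      ∫⁻ h, powMeasure μ b {w | c (Fin.cons h w) ≠ 0} ∂μ := by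
    rw [← hcons.measure_preimage hS.nullMeasurableSet, Measure.prod_apply (hcons.measurable hS)]
    rfl
  obtain ⟨h, hh, hle⟩ := exists_notMem_null_le_lintegral (μ := μ)
    (f := fun h => powMeasure μ b {w | c (Fin.cons h w) ≠ 0})
    (measurable_measure_prodMk_left (hcons.measurable hS)).aemeasurable (ae_iff.1 hcocycle)
  refine ⟨fun w => c (Fin.cons h w), hc.comp (hcons.measurable.comp measurable_prodMk_left), ?_,
    hfubini ▸ hle⟩
  filter_upwards [not_not.1 hh] with y hy
  rw [coboundary_cons] at hy
  exact (sub_eq_zero.1 hy).symm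

variable {X : Type*} {b : ℕ} {φ : X → (Fin (b + 1) → G) → B}

/-- Partial sums of a series of primitives: `s (n + 1) x - s n x` is a small primitive of the small
cocycle `φ (ρ (n + 1)) - φ (ρ n)`, where `ρ n` is a representative of the label `N n x`. -/
theorem exists_seq_coboundary_ae_eq [Countable B] {N : ℕ → X → ℕ}
    (hN : ∀ n, (N n).FactorsThrough (N (n + 1)))
    (hNφ : ∀ n x x', N n x = N n x' → powMeasure μ (b + 1) {y | φ x y ≠ φ x' y} ≤ 2⁻¹ ^ n)
    (hφ : ∀ x, Measurable (φ x)) (h0 : ∀ x, coboundary (φ x) =ᵐ[powMeasure μ (b + 2)] 0) :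
    ∃ s : ℕ → X → (Fin b → G) → B, (∀ n x, Measurable (s n x)) ∧
      (∀ n, (s n).FactorsThrough (N n)) ∧
      (∀ n x, powMeasure μ (b + 1) {y | coboundary (s n x) y ≠ φ x y} ≤ 2⁻¹ ^ n) ∧
      ∀ n x, powMeasure μ b {w | s (n + 1) x w ≠ s n x w} ≤ 2⁻¹ ^ n := by
  cases isEmpty_or_nonempty X
  · exact ⟨fun _ x => isEmptyElim x, fun _ x => isEmptyElim x, fun _ x => isEmptyElim x,
      fun _ x => isEmptyElim x, fun _ x => isEmptyElim x⟩
  let ρ : ℕ → X → X := fun n x => Function.invFun (N n) (N n x)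
  have hρ (n x) : N n (ρ n x) = N n x := Function.invFun_eq ⟨x, rfl⟩
  have hρN (n) : (ρ n).FactorsThrough (N n) := fun _ _ => congrArg (Function.invFun (N n))
  choose e₀ he₀m he₀ _ using fun x => exists_coboundary_ae_eq μ (hφ x) (h0 x)
  have hdiff (x x') : coboundary (φ x' - φ x) =ᵐ[powMeasure μ (b + 2)] 0 := by
    filter_upwards [h0 x', h0 x] with y h1 h2
    exact (coboundary_sub _ _ _).trans (by rw [h1, h2, Pi.zero_apply, sub_zero])
  choose e hem he hele using fun x x' => exists_coboundary_ae_eq μ ((hφ x').sub (hφ x)) (hdiff x x')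
  let s : ℕ → X → (Fin b → G) → B := fun n =>
    Nat.rec (fun x => e₀ (ρ 0 x)) (fun n s x => s x + e (ρ n x) (ρ (n + 1) x)) n
  have hcob (n x) : coboundary (s n x) =ᵐ[powMeasure μ (b + 1)] φ (ρ n x) := by
    induction n with
    | zero => exact he₀ _
    | succ n ih =>
      filter_upwards [ih, he (ρ n x) (ρ (n + 1) x)] with y h1 h2
      exact (coboundary_add _ _ _).trans (by rw [h1, h2, Pi.sub_apply, add_sub_cancel])
  refine ⟨s, fun n x => ?_, fun n => ?_, fun n x => ?_, fun n x => ?_⟩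
  · induction n with
    | zero => exact he₀m _
    | succ n ih => exact ih.add (hem _ _)
  · induction n with
    | zero => exact fun x x' h => congrArg e₀ (hρN 0 h)
    | succ n ih =>
      exact fun x x' h => congrArg₂ (· + ·) (ih (hN n h))
        (congrArg₂ e (hρN n (hN n h)) (hρN (n + 1) h))
  · refine (measure_mono_ae ?_).trans (hNφ n _ _ (hρ n x))
    filter_upwards [hcob n x] with y hy hne using fun h => hne (hy.trans h)
  · calc powMeasure μ b {w | s (n + 1) x w ≠ s n x w}
        = powMeasure μ b {w | e (ρ n x) (ρ (n + 1) x) w ≠ 0} := by simp [s]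
      _ ≤ powMeasure μ (b + 1) {y | (φ (ρ (n + 1) x) - φ (ρ n x)) y ≠ 0} := hele _ _
      _ = powMeasure μ (b + 1) {y | φ (ρ (n + 1) x) y ≠ φ (ρ n x) y} := by
          simp only [Pi.sub_apply, ne_eq, sub_eq_zero]
      _ ≤ 2⁻¹ ^ n := hNφ n _ _ ((hN n (hρ (n + 1) x)).trans (hρ n x).symm)

theorem IsTame.exists_coboundary_ae_eq [Countable B] [TopologicalSpace X] [MeasurableSpace X]
    {𝒩 : Set (Set X)} (h𝒩 : IsSetAlgebra 𝒩) (hm : ∀ C ∈ 𝒩, MeasurableSet C) {x₀ : X}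
    (hφ : ∀ x, Measurable (φ x)) (ht : IsTame 𝒩 x₀ (powMeasure μ (b + 1)) φ)
    (h0 : ∀ x, coboundary (φ x) =ᵐ[powMeasure μ (b + 2)] 0) :
    ∃ ψ : X → (Fin b → G) → B, Measurable (Function.uncurry ψ) ∧
      IsTame 𝒩 x₀ (powMeasure μ b) ψ ∧
      ∀ x, coboundary (ψ x) =ᵐ[powMeasure μ (b + 1)] φ x := by
  obtain ⟨N, hN, hNN, hNφ⟩ := ht.exists_seq_isLabel h𝒩
  obtain ⟨s, hs, hsN, hsφ, hss⟩ := exists_seq_coboundary_ae_eq μ hNN hNφ hφ h0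
  obtain ⟨f, hf, hfs⟩ := exists_measurable_of_eventually_eq fun n =>
    measurable_uncurry_of_factorsThrough (hs n) ((hN n).measurable hm) (hsN n)
  have hlim (x) : ∀ᵐ w ∂powMeasure μ b, ∀ᶠ n in atTop, s n x w = f (x, w) := by
    filter_upwards [ae_exists_eventually_eq (s := (s · x)) (hss · x)] with w ⟨c, hc⟩
    rwa [hfs (x, w) c hc]
  refine ⟨Function.curry f, hf, fun ε hε => ?_, fun x => ?_⟩
  · obtain ⟨n, hn⟩ := ENNReal.exists_inv_two_pow_lt (a := ε / 4) (by simpa using hε)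
    refine ⟨N n, hN n, fun x x' hx => ?_⟩
    have hmeas (x) : powMeasure μ b {w | s n x w ≠ f (x, w)} ≤ 2 * 2⁻¹ ^ n :=
      measure_ne_le_of_eventually_eq (hss · x) (hlim x) n
    calc powMeasure μ b {w | f (x, w) ≠ f (x', w)}
        ≤ powMeasure μ b {w | f (x, w) ≠ s n x w} + powMeasure μ b {w | s n x w ≠ f (x', w)} :=
          measure_ne_le_add _ _ _ _
      _ ≤ 2 * 2⁻¹ ^ n + 2 * 2⁻¹ ^ n := by
          gcongr
          · simpa only [ne_comm] using hmeas x
          · rw [hsN n hx]; exact hmeas x'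
      _ = 4 * 2⁻¹ ^ n := by rw [← add_mul]; norm_num
      _ ≤ 4 * (ε / 4) := by gcongr
      _ = ε := ENNReal.mul_div_cancel (by simp) (by simp)
  · filter_upwards [ae_removeNth μ (hlim x), ae_eventually_eq_of_measure_ne_le (hsφ · x)]
      with y h1 h2
    obtain ⟨n, h1, h2⟩ := ((eventually_all.2 h1).and h2).exists
    exact (coboundary_congr fun i => (h1 i).symm).trans h2

end Primitive

/-! ### Continuity in measure of translations -/

theorem exists_forall_measure_lt_of_absolutelyContinuous {Z : Type*} [MeasurableSpace Z]
    {ν l : Measure Z} [IsFiniteMeasure ν] [SigmaFinite l] (h : ν ≪ l) {ε : ℝ≥0∞} (hε : ε ≠ 0) :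
    ∃ δ : ℝ≥0∞, δ ≠ 0 ∧ ∀ s, l s < δ → ν s < ε := by
  obtain ⟨δ, hδ, H⟩ := exists_pos_setLIntegral_lt_of_measure_lt
    (Measure.lintegral_rnDeriv_lt_top ν l).ne hε
  refine ⟨δ, hδ.ne', fun s hs => ?_⟩
  rw [← Measure.withDensity_rnDeriv_eq ν l h, withDensity_apply' _ s]
  exact H s hs

theorem exists_finset_measure_notMem_le {Y B : Type*} [MeasurableSpace Y] (ν : Measure Y)
    [IsFiniteMeasure ν] [Countable B] [MeasurableSpace B] [MeasurableSingletonClass B] {c : Y → B}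
    (hc : Measurable c) {ε : ℝ≥0∞} (hε : ε ≠ 0) : ∃ F : Finset B, ν {y | c y ∉ F} ≤ ε := by
  have hfin : ∑' a, ν (c ⁻¹' {a}) ≠ ∞ := by
    rw [← measure_iUnion (fun a a' h => Disjoint.preimage c (Set.disjoint_singleton.2 h))
      fun a => hc (measurableSet_singleton a)]
    exact measure_ne_top ν _
  obtain ⟨F, hF⟩ := ((ENNReal.tendsto_tsum_compl_atTop_zero hfin).eventually
    (ge_mem_nhds (pos_iff_ne_zero.2 hε))).exists
  refine ⟨F, (measure_mono fun y hy => ?_).trans ((measure_iUnion_le _).trans hF)⟩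
  exact Set.mem_iUnion.2 ⟨⟨c y, hy⟩, rfl⟩

/-- A probability measure on `G^b` with the same null sets as the product of the Haar measures.
Tameness refers to it, since it requires a finite measure. -/
noncomputable abbrev refMeasure {G : Type*} [MeasurableSpace G] (μ : Measure G) [SFinite μ]
    (b : ℕ) : Measure (Fin b → G) :=
  powMeasure μ.toFinite b

section RefMeasure

variable {G : Type*} [MeasurableSpace G] (μ : Measure G) [SigmaFinite μ] (b : ℕ)

theorem refMeasure_absolutelyContinuous : refMeasure μ b ≪ powMeasure μ b :=
  powMeasure_absolutelyContinuous _ (toFinite_absolutelyContinuous μ) b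

theorem absolutelyContinuous_refMeasure : powMeasure μ b ≪ refMeasure μ b :=
  powMeasure_absolutelyContinuous _ (absolutelyContinuous_toFinite μ) b

end RefMeasure

/-- The action of `g` on a function on `G^b` with values in a module, pointwise as in `act`. -/
def translate {G B : Type*} [Group G] [SMul G B] {b : ℕ} (g : G) (c : (Fin b → G) → B)
    (y : Fin b → G) : B :=
  g • c fun i => g⁻¹ * y i

/-- The equivariant extension of a family given on the slice of the tuples starting with `1`. -/
def homogenize {G B : Type*} [Group G] [SMul G B] {k b : ℕ} (t : (Fin k → G) → (Fin b → G) → B)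
    (x : Fin (k + 1) → G) : (Fin b → G) → B :=
  translate (x 0) (t fun j => (x 0)⁻¹ * x j.succ)

/-- A system of algebras of Borel sets with null frontier in the powers of `G`, stable under the
structure maps of the homogeneous bar resolution. -/
structure IsTameSystem {G : Type*} [Group G] [TopologicalSpace G] [MeasurableSpace G]
    (μ : Measure G) (𝒩 : ∀ q : ℕ, Set (Set (Fin q → G))) : Prop where
  isTopologicalSetAlgebra : ∀ q, IsTopologicalSetAlgebra (𝒩 q)
  measurableSet : ∀ q, ∀ C ∈ 𝒩 q, MeasurableSet C
  null_frontier : ∀ q, ∀ C ∈ 𝒩 q, powMeasure μ q (frontier C) = 0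
  face : ∀ q (i : Fin (q + 1)), ∀ C ∈ 𝒩 q,
    (fun x : Fin (q + 1) → G => i.removeNth x) ⁻¹' C ∈ 𝒩 (q + 1)
  quot : ∀ q, ∀ C ∈ 𝒩 q,
    (fun (x : Fin (q + 1) → G) (j : Fin q) => (x 0)⁻¹ * x j.succ) ⁻¹' C ∈ 𝒩 (q + 1)
  mul_right : ∀ q (h : G), ∀ C ∈ 𝒩 q, (fun (x : Fin q → G) j => x j * h) ⁻¹' C ∈ 𝒩 q

theorem IsTameSystem.isSetAlgebra {G : Type*} [Group G] [TopologicalSpace G] [MeasurableSpace G]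
    {μ : Measure G} {𝒩 : ∀ q : ℕ, Set (Set (Fin q → G))} (h𝒩 : IsTameSystem μ 𝒩) (q : ℕ) :
    IsSetAlgebra (𝒩 q) :=
  (h𝒩.isTopologicalSetAlgebra q).toIsSetAlgebra

theorem eventually_smul_eq {G B : Type*} [TopologicalSpace G] [TopologicalSpace B]
    [DiscreteTopology B] [SMul G B] [ContinuousSMul G B] (g₀ : G) (a : B) :
    ∀ᶠ g in 𝓝 g₀, g • a = g₀ • a := by
  have h : ContinuousAt (fun g : G => g • a) g₀ := by fun_prop
  exact h.eventually (mem_nhds_discrete.2 (Set.mem_singleton (g₀ • a)))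

section Translation

variable {G : Type*} [Group G] [TopologicalSpace G] [IsTopologicalGroup G] [LocallyCompactSpace G]
  [SecondCountableTopology G] [T2Space G] [MeasurableSpace G] [BorelSpace G] (μ : Measure G)
  [μ.IsHaarMeasure]

theorem exists_isCompact_refMeasure_compl_lt (b : ℕ) {ε : ℝ≥0∞} (hε : ε ≠ 0) :
    ∃ K : Set (Fin b → G), IsCompact K ∧ refMeasure μ b Kᶜ < ε := by
  obtain ⟨K, -, hK, h⟩ := (MeasurableSet.univ (α := Fin b → G)).exists_isCompact_sdiff_lt
    (measure_ne_top (refMeasure μ b) _) hε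
  exact ⟨K, hK, by rwa [Set.compl_eq_univ_sdiff]⟩

/-- Up to a small set, only the Haar measure on a compact set matters, and it is invariant. -/
theorem exists_eventually_refMeasure_preimage_le (b : ℕ) (g₀ : G) {ε : ℝ≥0∞} (hε : ε ≠ 0) :
    ∃ δ : ℝ≥0∞, δ ≠ 0 ∧ ∀ᶠ g in 𝓝 g₀, ∀ E, MeasurableSet E → refMeasure μ b E ≤ δ →
      refMeasure μ b {y | (fun i => g⁻¹ * y i) ∈ E} ≤ ε := by
  have hε2 : ε / 2 ≠ 0 := by simpa using hε
  obtain ⟨K, hK, hKε⟩ := exists_isCompact_refMeasure_compl_lt μ b hε2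
  obtain ⟨V, hV, hVg⟩ := exists_compact_mem_nhds g₀
  set K' := (fun (z : G × (Fin b → G)) i => z.1⁻¹ * z.2 i) '' (V ×ˢ K)
  have hK' : IsCompact K' := (hV.prod hK).image (by fun_prop)
  obtain ⟨δ₁, hδ₁, h1⟩ := exists_forall_measure_lt_of_absolutelyContinuous
    (refMeasure_absolutelyContinuous μ b) hε2
  have : IsFiniteMeasure ((powMeasure μ b).restrict K') := ⟨by
    rw [Measure.restrict_apply_univ]; exact hK'.measure_lt_top⟩
  obtain ⟨δ, hδ, h2⟩ := exists_forall_measure_lt_of_absolutelyContinuous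
    (Measure.restrict_le_self.absolutelyContinuous.trans (absolutelyContinuous_refMeasure μ b) :
      (powMeasure μ b).restrict K' ≪ _) hδ₁
  obtain ⟨δ', hδ', hδδ⟩ := exists_between (pos_iff_ne_zero.2 hδ)
  refine ⟨δ', hδ'.ne', ?_⟩
  filter_upwards [hVg] with g hg E hE hEδ
  have hEK : powMeasure μ b (E ∩ K') < δ₁ := by
    rw [← Measure.restrict_apply hE]
    exact h2 E (hEδ.trans_lt hδδ)
  have hinv := (measurePreserving_diag μ b g⁻¹).measure_preimage
    (hE.inter hK'.measurableSet).nullMeasurableSet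
  calc refMeasure μ b {y | (fun i => g⁻¹ * y i) ∈ E}
      ≤ refMeasure μ b (Kᶜ ∪ (fun y i => g⁻¹ * y i) ⁻¹' (E ∩ K')) := by
        refine measure_mono fun y hy => ?_
        by_cases hyK : y ∈ K
        · exact Or.inr ⟨hy, (g, y), ⟨hg, hyK⟩, rfl⟩
        · exact Or.inl hyK
    _ ≤ ε / 2 + ε / 2 := (measure_union_le _ _).trans
        (add_le_add hKε.le (h1 _ (hinv.trans_lt hEK)).le)
    _ = ε := ENNReal.add_halves ε

theorem eventually_refMeasure_preimage_sdiff_le (b : ℕ) (g₀ : G) {E : Set (Fin b → G)}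
    (hE : MeasurableSet E) {ε : ℝ≥0∞} (hε : ε ≠ 0) :
    ∀ᶠ g in 𝓝 g₀, refMeasure μ b
      {y | (fun i => g₀⁻¹ * y i) ∈ E ∧ (fun i => g⁻¹ * y i) ∉ E} ≤ ε := by
  have hε2 : ε / 2 ≠ 0 := by simpa using hε
  obtain ⟨K, hK, hKε⟩ := exists_isCompact_refMeasure_compl_lt μ b hε2
  let f : G → C(Fin b → G, Fin b → G) := fun g => ⟨fun y i => g⁻¹ * y i, by fun_prop⟩
  have hf : Continuous f := ContinuousMap.continuous_of_continuous_uncurry _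
    (by fun_prop : Continuous fun (z : G × (Fin b → G)) i => z.1⁻¹ * z.2 i)
  have hfm : ∀ g, MeasurePreserving (f g) (powMeasure μ b) (powMeasure μ b) := fun g =>
    measurePreserving_diag μ b g⁻¹
  have hK0 : IsCompact (f g₀ '' K) := hK.image (f g₀).continuous
  have hfin : powMeasure μ b (E ∩ f g₀ '' K) ≠ ∞ :=
    ((measure_mono Set.inter_subset_right).trans_lt hK0.measure_lt_top).ne
  have hlim := tendsto_measure_symmDiff_preimage_nhds_zero (hf.tendsto g₀) (.of_forall hfm)
    (hfm g₀) (hE.inter hK0.measurableSet).nullMeasurableSet hfin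
  obtain ⟨δ, hδ, h1⟩ := exists_forall_measure_lt_of_absolutelyContinuous
    (refMeasure_absolutelyContinuous μ b) hε2
  filter_upwards [hlim.eventually (gt_mem_nhds (pos_iff_ne_zero.2 hδ))] with g hg
  calc refMeasure μ b {y | f g₀ y ∈ E ∧ f g y ∉ E}
      ≤ refMeasure μ b
          (Kᶜ ∪ symmDiff (f g ⁻¹' (E ∩ f g₀ '' K)) (f g₀ ⁻¹' (E ∩ f g₀ '' K))) := by
        refine measure_mono fun y hy => ?_
        by_cases hyK : y ∈ K
        · exact Or.inr (Or.inr ⟨⟨hy.1, y, hyK, rfl⟩, fun h => hy.2 h.1⟩)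
        · exact Or.inl hyK
    _ ≤ ε / 2 + ε / 2 := (measure_union_le _ _).trans (add_le_add hKε.le (h1 _ hg).le)
    _ = ε := ENNReal.add_halves ε

variable {B : Type*} [Countable B] [TopologicalSpace B] [DiscreteTopology B] [MeasurableSpace B]
  [DiscreteMeasurableSpace B] [SMul G B] [ContinuousSMul G B]

theorem eventually_refMeasure_translate_ne_le (b : ℕ) (g₀ : G) {c : (Fin b → G) → B}
    (hc : Measurable c) {ε : ℝ≥0∞} (hε : ε ≠ 0) :
    ∀ᶠ g in 𝓝 g₀, refMeasure μ b {y | translate g c y ≠ translate g₀ c y} ≤ ε := by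
  have hε2 : ε / 2 ≠ 0 := by simpa using hε
  obtain ⟨F, hF⟩ := exists_finset_measure_notMem_le (refMeasure μ b)
    (hc.comp (measurePreserving_diag μ b g₀⁻¹).measurable) hε2
  let D : G → B → Set (Fin b → G) := fun g a =>
    {y | (fun i => g₀⁻¹ * y i) ∈ c ⁻¹' {a} ∧ (fun i => g⁻¹ * y i) ∉ c ⁻¹' {a}}
  obtain ⟨η, hη, hηF⟩ : ∃ η : ℝ≥0∞, η ≠ 0 ∧ (F.card : ℝ≥0∞) * η ≤ ε / 2 :=
    ⟨ε / 2 / F.card, ENNReal.div_ne_zero.2 ⟨hε2, by simp⟩, ENNReal.mul_div_le⟩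
  have hD : ∀ᶠ g in 𝓝 g₀, ∀ a ∈ F, g • a = g₀ • a ∧ refMeasure μ b (D g a) ≤ η :=
    (Finset.eventually_all _).2 fun a _ => (eventually_smul_eq g₀ a).and
      (eventually_refMeasure_preimage_sdiff_le μ b g₀ (hc (measurableSet_singleton a)) hη)
  filter_upwards [hD] with g hg
  calc refMeasure μ b {y | translate g c y ≠ translate g₀ c y}
      ≤ refMeasure μ b ({y | c (fun i => g₀⁻¹ * y i) ∉ F} ∪ ⋃ a ∈ F, D g a) := by
        refine measure_mono fun y hy => ?_
        by_cases hyF : c (fun i => g₀⁻¹ * y i) ∈ F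
        · refine Or.inr (Set.mem_biUnion hyF ⟨rfl, fun h => hy ?_⟩)
          have h' : c (fun i => g⁻¹ * y i) = c fun i => g₀⁻¹ * y i := h
          rw [translate, h', (hg _ hyF).1, translate]
        · exact Or.inl hyF
    _ ≤ ε / 2 + ∑ _ ∈ F, η :=
        (measure_union_le _ _).trans (add_le_add hF ((measure_biUnion_finset_le _ _).trans
          (Finset.sum_le_sum fun a ha => (hg a ha).2)))
    _ ≤ ε / 2 + ε / 2 := by rw [Finset.sum_const, nsmul_eq_mul]; gcongr
    _ = ε := ENNReal.add_halves ε

theorem exists_eventually_refMeasure_translate_ne_le (b : ℕ) (g₀ : G) {ε : ℝ≥0∞} (hε : ε ≠ 0) :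
    ∃ δ : ℝ≥0∞, δ ≠ 0 ∧ ∀ c : (Fin b → G) → B, Measurable c → ∀ᶠ g in 𝓝 g₀,
      ∀ c' : (Fin b → G) → B, Measurable c' → refMeasure μ b {y | c' y ≠ c y} ≤ δ →
        refMeasure μ b {y | translate g c' y ≠ translate g₀ c y} ≤ ε := by
  have hε2 : ε / 2 ≠ 0 := by simpa using hε
  obtain ⟨δ, hδ, hpre⟩ := exists_eventually_refMeasure_preimage_le μ b g₀ hε2
  refine ⟨δ, hδ, fun c hc => ?_⟩
  filter_upwards [hpre, eventually_refMeasure_translate_ne_le μ b g₀ hc hε2] with g hg hgc c' hc' h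
  calc refMeasure μ b {y | translate g c' y ≠ translate g₀ c y}
      ≤ refMeasure μ b {y | translate g c' y ≠ translate g c y} +
          refMeasure μ b {y | translate g c y ≠ translate g₀ c y} := measure_ne_le_add _ _ _ _
    _ ≤ ε / 2 + ε / 2 := by
        refine add_le_add ((measure_mono fun y => mt fun e => congrArg (g • ·) e).trans
          (hg _ (measurableSet_eq_fun hc' hc).compl h)) hgc
    _ = ε := ENNReal.add_halves ε

variable {μ}

theorem IsTame.homogenize {𝒩 : ∀ q : ℕ, Set (Set (Fin q → G))} (h𝒩 : IsTameSystem μ 𝒩) {k b : ℕ}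
    {t : (Fin k → G) → (Fin b → G) → B} (hm : ∀ u, Measurable (t u))
    (ht : IsTame (𝒩 k) 1 (refMeasure μ b) t) :
    IsTame (𝒩 (k + 1)) 1 (refMeasure μ b) (homogenize t) := by
  intro ε hε
  refine exists_isLabel_of_local (h𝒩.isTopologicalSetAlgebra _) 1 fun x => ?_
  let quot : (Fin (k + 1) → G) → Fin k → G := fun x j => (x 0)⁻¹ * x j.succ
  obtain ⟨δ, hδ, hcont⟩ := exists_eventually_refMeasure_translate_ne_le μ b (x 0) (B := B)
    (ε := ε / 2) (by simpa using hε)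
  obtain ⟨N, hN, hNt⟩ := ht δ hδ
  have hN' : IsLabel (𝒩 (k + 1)) 1 (N ∘ quot) :=
    hN.comp (by fun_prop) (h𝒩.quot k) (by ext j; simp [quot])
  obtain ⟨U, hU, hUfin⟩ := hN'.locallyFiniteValued x
  let r : ℕ → Fin k → G := Function.invFun N
  have hclose : ∀ᶠ z in 𝓝 x, refMeasure μ b
      {y | MooreCohomology.homogenize t z y ≠ translate (x 0) (t (r (N (quot z)))) y} ≤ ε / 2 := by
    have hnear := hUfin.eventually_all.2 fun l _ =>
      (continuous_apply 0).continuousAt.eventually (hcont (t (r l)) (hm _))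
    filter_upwards [hnear, hU] with z hz hzU
    exact hz _ (Set.mem_image_of_mem _ hzU) _ (hm _)
      (hNt _ _ (Function.invFun_eq ⟨_, rfl⟩).symm)
  refine ⟨_, hclose, _, hN', fun z hz z' hz' (hzz : N (quot z) = N (quot z')) => ?_⟩
  calc _ ≤ _ := measure_ne_le_add _ _ (translate (x 0) (t (r (N (quot z))))) _
    _ ≤ ε / 2 + ε / 2 := add_le_add hz (by simpa only [hzz, ne_comm, Set.mem_ofPred_eq] using hz')
    _ = ε := ENNReal.add_halves ε

end Translation

/-! ### Regular families -/

section TranslateLemmas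

variable {G B : Type*} [Group G] {n : ℕ}

theorem translate_one [MulAction G B] (c : (Fin n → G) → B) : translate 1 c = c := by
  funext y
  simp [translate]

theorem coboundary_translate [AddCommGroup B] [DistribMulAction G B] (g : G)
    (c : (Fin n → G) → B) : coboundary (translate g c) = translate g (coboundary c) := by
  funext y
  simp only [coboundary, translate, Finset.smul_sum]
  exact Finset.sum_congr rfl fun i _ => smul_comm _ _ _

end TranslateLemmas

theorem measurable_smul_of_countable {G B : Type*} [TopologicalSpace G]
    [MeasurableSpace G] [BorelSpace G] [Countable B] [MeasurableSpace B] [DiscreteMeasurableSpace B]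
    [TopologicalSpace B] [DiscreteTopology B] [SMul G B] [ContinuousSMul G B] :
    Measurable fun z : G × B => z.1 • z.2 :=
  measurable_from_prod_countable_left fun a => (by fun_prop : Continuous (· • a)).measurable

section Regular

variable {G : Type*} [Group G] [TopologicalSpace G] [MeasurableSpace G] {μ : Measure G}
  {𝒩 : ∀ q : ℕ, Set (Set (Fin q → G))} {B : Type*} {k b : ℕ}

variable (μ 𝒩) in
/-- An equivariant and jointly measurable function that is tame in the first group of variables,
both on `G^(k+1)` and on the slice of tuples that start with `1`. -/
structure IsRegular [SFinite μ] [MeasurableSpace B] [SMul G B]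
    (τ : (Fin (k + 1) → G) → (Fin b → G) → B) : Prop where
  equivariant : ∀ g x y, τ (fun i => g * x i) (fun i => g * y i) = g • τ x y
  measurable : Measurable (Function.uncurry τ)
  tame : IsTame (𝒩 (k + 1)) 1 (refMeasure μ b) τ
  tame_slice : IsTame (𝒩 k) 1 (refMeasure μ b) fun u => τ (Fin.cons 1 u)

theorem IsTame.coboundary_left [SFinite μ] [AddCommGroup B] (h𝒩 : IsTameSystem μ 𝒩) {n : ℕ}
    {τ : (Fin n → G) → (Fin b → G) → B} (h : IsTame (𝒩 n) 1 (refMeasure μ b) τ) :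
    IsTame (𝒩 (n + 1)) 1 (refMeasure μ b) fun x y => coboundary (fun x => τ x y) x :=
  IsTame.sum (h𝒩.isSetAlgebra _) fun i _ =>
    (h.comp (by unfold Fin.removeNth; fun_prop) (h𝒩.face n i) rfl).zsmul _

theorem IsRegular.homogenize_slice [SFinite μ] [MeasurableSpace B] [MulAction G B]
    {φ : (Fin (k + 1) → G) → (Fin b → G) → B} (h : IsRegular μ 𝒩 φ) :
    homogenize (fun u => φ (Fin.cons 1 u)) = φ := by
  funext x y
  have hx : x = fun i => x 0 * (Fin.cons 1 fun j => (x 0)⁻¹ * x j.succ : Fin (k + 1) → G) i := by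
    funext i
    cases i using Fin.cases <;> simp
  conv_rhs => rw [hx]
  simpa [homogenize, translate] using
    (h.equivariant (x 0) (Fin.cons 1 fun j => (x 0)⁻¹ * x j.succ) fun i => (x 0)⁻¹ * y i).symm

variable [AddCommGroup B] [Countable B] [MeasurableSpace B] [DiscreteMeasurableSpace B]
  [DistribMulAction G B]

theorem IsRegular.zsmul [SFinite μ]
    {τ : (Fin (k + 1) → G) → (Fin b → G) → B} (h : IsRegular μ 𝒩 τ) (n : ℤ) :
    IsRegular μ 𝒩 fun x y => n • τ x y where
  equivariant g x y := by rw [h.equivariant, smul_comm]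
  measurable := (measurable_of_countable fun b : B => n • b).comp h.measurable
  tame := h.tame.zsmul n
  tame_slice := h.tame_slice.zsmul n

theorem IsRegular.coboundary_left [SFinite μ] (h𝒩 : IsTameSystem μ 𝒩)
    {τ : (Fin (k + 1) → G) → (Fin b → G) → B} (h : IsRegular μ 𝒩 τ) :
    IsRegular μ 𝒩 fun (x : Fin (k + 1 + 1) → G) y => coboundary (fun x => τ x y) x where
  equivariant g x y := by
    simp only [coboundary, Finset.smul_sum]
    exact Finset.sum_congr rfl fun i _ =>
      (congrArg _ (h.equivariant g (i.removeNth x) y)).trans (smul_comm _ _ _).symm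
  measurable := by
    refine measurable_coboundary (f := fun z x => τ x z.2) (y := Prod.fst) fun i => ?_
    have hface : Measurable fun z : (Fin (k + 1 + 1) → G) × (Fin b → G) =>
        ((fun j => z.1 (i.succAbove j) : Fin (k + 1) → G), z.2) := by fun_prop
    exact h.measurable.comp hface
  tame := h.tame.coboundary_left h𝒩
  tame_slice := by
    simp only [coboundary_cons, sub_eq_add_neg, ← neg_one_zsmul (coboundary _ _)]
    exact h.tame.add (h𝒩.isSetAlgebra _) ((h.tame_slice.coboundary_left h𝒩).zsmul (-1))

variable [IsTopologicalGroup G] [LocallyCompactSpace G] [SecondCountableTopology G] [T2Space G]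
  [BorelSpace G] [TopologicalSpace B] [DiscreteTopology B] [ContinuousSMul G B]
  [μ.IsHaarMeasure]

theorem isRegular_homogenize (h𝒩 : IsTameSystem μ 𝒩) {t : (Fin k → G) → (Fin b → G) → B}
    (hm : Measurable (Function.uncurry t)) (ht : IsTame (𝒩 k) 1 (refMeasure μ b) t) :
    IsRegular μ 𝒩 (homogenize t) where
  equivariant g x y := by
    simp only [homogenize, translate, mul_inv_rev, mul_smul, mul_assoc, inv_mul_cancel_left]
  measurable := by
    have hslice : Measurable fun z : (Fin (k + 1) → G) × (Fin b → G) =>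
        ((fun j => (z.1 0)⁻¹ * z.1 j.succ : Fin k → G), fun j => (z.1 0)⁻¹ * z.2 j) := by fun_prop
    have hfirst : Measurable fun z : (Fin (k + 1) → G) × (Fin b → G) => z.1 0 := by fun_prop
    exact measurable_smul_of_countable.comp (hfirst.prodMk (hm.comp hslice))
  tame := ht.homogenize h𝒩 fun u => hm.comp measurable_prodMk_left
  tame_slice := by simpa [homogenize, translate_one] using ht

theorem IsRegular.exists_primitive (h𝒩 : IsTameSystem μ 𝒩)
    {φ : (Fin (k + 1) → G) → (Fin (b + 1) → G) → B} (h : IsRegular μ 𝒩 φ)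
    (h0 : ∀ x, coboundary (φ x) =ᵐ[powMeasure μ (b + 2)] 0) :
    ∃ τ : (Fin (k + 1) → G) → (Fin b → G) → B, IsRegular μ 𝒩 τ ∧
      ∀ x, coboundary (τ x) =ᵐ[powMeasure μ (b + 1)] φ x := by
  obtain ⟨ψ, hψm, hψt, hψ⟩ := h.tame_slice.exists_coboundary_ae_eq μ.toFinite (h𝒩.isSetAlgebra k)
    (h𝒩.measurableSet k) (fun u => h.measurable.comp measurable_prodMk_left)
    fun u => (refMeasure_absolutelyContinuous μ _).ae_le (h0 _)
  refine ⟨homogenize ψ, isRegular_homogenize h𝒩 hψm hψt, fun x => ?_⟩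
  have hx := (absolutelyContinuous_refMeasure μ _).ae_le (hψ fun j => (x 0)⁻¹ * x j.succ)
  rw [homogenize, coboundary_translate, ← h.homogenize_slice]
  filter_upwards [(measurePreserving_diag μ (b + 1) (x 0)⁻¹).quasiMeasurePreserving.ae hx]
    with y hy
  exact congrArg (x 0 • ·) hy

end Regular

/-! ### Comparison of cocycles on mixed tuples -/

/-- The Alexander–Whitney map: the function of `z ∈ α^(p+1)`, for `p = k + b`, obtained by filling
the front face `z₀, …, z_k` and the back face `z_k, …, z_p` into the two groups of variables
of `φ`. -/
def alexanderWhitney {α B : Type*} (p : ℕ) {k b : ℕ}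
    (φ : (Fin (k + 1) → α) → (Fin (b + 1) → α) → B) (z : Fin (p + 1) → α) : B :=
  φ (fun i => z (Fin.ofNat (p + 1) i)) fun j => z (Fin.ofNat (p + 1) (k + j))

/-- The `n`-th natural number different from `i`. -/
def skip (i n : ℕ) : ℕ := if n < i then n else n + 1

section AlexanderWhitney

variable {α B : Type*}

theorem alexanderWhitney_comp_val {p k b : ℕ} (hp : p = k + b)
    (φ : (Fin (k + 1) → α) → (Fin (b + 1) → α) → B) (Z : ℕ → α) :
    alexanderWhitney p φ (fun i => Z i) = φ (fun i => Z i) fun j => Z (k + j) := by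
  subst hp
  have hfront (i : Fin (k + 1)) : (i : ℕ) % (k + b + 1) = i := Nat.mod_eq_of_lt (by omega)
  have hback (j : Fin (b + 1)) : (k + j : ℕ) % (k + b + 1) = k + j := Nat.mod_eq_of_lt (by omega)
  simp only [alexanderWhitney, Fin.val_ofNat, hfront, hback]

theorem alexanderWhitney_eq_snoc {k b : ℕ} (φ : (Fin (k + 1) → α) → (Fin (b + 1) → α) → B)
    (z : Fin (k + (b + 1)) → α) :
    alexanderWhitney (k + b) φ z =
      φ (Fin.snoc (fun i => z (Fin.castAdd (b + 1) i)) (z (Fin.natAdd k 0)))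
        fun j => z (Fin.natAdd k j) := by
  obtain ⟨Z, rfl⟩ : ∃ Z : ℕ → α, (fun i : Fin (k + b + 1) => Z i) = z :=
    ⟨fun n => z (Fin.ofNat (k + b + 1) n), funext fun i => congrArg z (Fin.ofNat_val_eq_self i)⟩
  rw [alexanderWhitney_comp_val rfl]
  congr 1
  funext i
  cases i using Fin.lastCases <;> simp

theorem coboundary_comp_val [AddCommGroup B] {n : ℕ} (f : (Fin n → α) → B) (Z : ℕ → α) :
    coboundary f (fun i => Z i) =
      ∑ i ∈ Finset.range (n + 1), (-1 : ℤ) ^ i • f fun j => Z (skip i j) := by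
  rw [Finset.sum_range]
  refine Finset.sum_congr rfl fun i _ => ?_
  congr 2
  funext j
  simp only [Fin.removeNth, Fin.succAbove, skip, Fin.lt_def, Fin.val_castSucc]
  split_ifs <;> rfl

theorem coboundary_alexanderWhitney [AddCommGroup B] {q k b : ℕ} (hq : q = k + b)
    (τ : (Fin (k + 1) → α) → (Fin (b + 1) → α) → B) (z : Fin (q + 2) → α) :
    coboundary (alexanderWhitney q τ) z =
      alexanderWhitney (q + 1)
        (fun (x : Fin (k + 1 + 1) → α) y => coboundary (fun x => τ x y) x) z +
      (-1 : ℤ) ^ k • alexanderWhitney (q + 1) (fun x => coboundary (τ x)) z := by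
  obtain ⟨Z, rfl⟩ : ∃ Z : ℕ → α, (fun i : Fin (q + 2) => Z i) = z :=
    ⟨fun n => z (Fin.ofNat (q + 2) n), funext fun i => congrArg z (Fin.ofNat_val_eq_self i)⟩
  -- The faces omitting `z_i` with `i ≤ k` are the first ones of the front variables, the others
  -- are the last ones of the back variables; `T` is the face that both have in addition.
  let F : ℕ → B := fun i =>
    (-1 : ℤ) ^ i • τ (fun a => Z (skip i a)) fun j => Z (skip i (k + j))
  let T : B := τ (fun a => Z a) fun j => Z (k + 1 + j)
  have htotal : coboundary (alexanderWhitney q τ) (fun i : Fin (q + 2) => Z i) =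
      ∑ i ∈ Finset.range (k + 1), F i + ∑ i ∈ Finset.range (b + 1), F (k + 1 + i) := by
    rw [coboundary_comp_val, ← Finset.sum_range_add, show k + 1 + (b + 1) = q + 2 by omega]
    exact Finset.sum_congr rfl fun i _ =>
      congrArg _ (alexanderWhitney_comp_val hq τ fun n => Z (skip i n))
  have hfront : alexanderWhitney (q + 1)
      (fun (x : Fin (k + 1 + 1) → α) y => coboundary (fun x => τ x y) x) (fun i => Z i) =
      ∑ i ∈ Finset.range (k + 1), F i + (-1 : ℤ) ^ (k + 1) • T := by
    rw [alexanderWhitney_comp_val (by omega), coboundary_comp_val, Finset.sum_range_succ]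
    refine congrArg₂ _ (Finset.sum_congr rfl fun i hi => ?_) ?_
    · have hskip (j : ℕ) : skip i (k + j) = k + 1 + j := by
        rw [skip, if_neg (by have := Finset.mem_range.1 hi; omega), Nat.add_right_comm]
      simp only [F, hskip]
    · simp only [T, skip, if_pos (Fin.is_lt _)]
  have hback : alexanderWhitney (q + 1) (fun x => coboundary (τ x)) (fun i => Z i) =
      ∑ i ∈ Finset.range (b + 1), (-1 : ℤ) ^ k • F (k + 1 + i) + T := by
    rw [alexanderWhitney_comp_val (by omega), coboundary_comp_val (Z := fun n => Z (k + n)),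
      Finset.sum_range_succ']
    refine congrArg₂ _ (Finset.sum_congr rfl fun i _ => ?_) ?_
    · have hx (a : Fin (k + 1)) : skip (k + 1 + i) a = a := if_pos (by omega)
      have hy (j : ℕ) : skip (k + 1 + i) (k + j) = k + skip (i + 1) j := by
        unfold skip; split_ifs <;> omega
      have hsign : (-1 : ℤ) ^ k * (-1) ^ (k + 1 + i) = (-1) ^ (i + 1) := by
        rw [← pow_add, show k + (k + 1 + i) = 2 * k + (i + 1) by omega, pow_add, pow_mul,
          neg_one_sq, one_pow, one_mul]
      simp only [F, hx, hy, smul_smul, hsign]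
    · simp [T, skip, Nat.add_right_comm, Nat.add_assoc]
  rw [htotal, hfront, hback, ← Finset.smul_sum, smul_add, smul_smul, ← pow_add,
    Even.neg_one_pow ⟨k, rfl⟩, one_smul, pow_succ, mul_neg_one, neg_smul]
  abel

end AlexanderWhitney

section SplitMeasure

variable {G : Type*} [MeasurableSpace G] (μ : Measure G) [SigmaFinite μ]

theorem measurePreserving_castAdd_natAdd (k n : ℕ) :
    MeasurePreserving (fun z : Fin (k + n) → G =>
      ((fun i => z (Fin.castAdd n i), fun j => z (Fin.natAdd k j)) : (Fin k → G) × (Fin n → G)))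
      (powMeasure μ (k + n)) ((powMeasure μ k).prod (powMeasure μ n)) :=
  (measurePreserving_sumPiEquivProdPi (fun _ : Fin k ⊕ Fin n => μ)).comp
    (measurePreserving_piCongrLeft (fun _ : Fin (k + n) => μ) finSumFinEquiv).symm

theorem measurePreserving_snoc (b : ℕ) :
    MeasurePreserving (fun z : G × (Fin b → G) => (Fin.snoc z.2 z.1 : Fin (b + 1) → G))
      (μ.prod (powMeasure μ b)) (powMeasure μ (b + 1)) := by
  convert (measurePreserving_piFinSuccAbove (fun _ : Fin (b + 1) => μ) (Fin.last b)).symm using 1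
  exact funext fun z => (Fin.insertNth_last' z.1 z.2).symm

variable [Group G] [MeasurableMul₂ G] [MeasurableInv G] [μ.IsMulLeftInvariant]

theorem ae_ae_snoc_mul {k : ℕ} {P : (Fin (k + 1) → G) → Prop} (h : ∀ᵐ x ∂powMeasure μ (k + 1), P x)
    (c : G) :
    ∀ᵐ g ∂μ, ∀ᵐ w ∂powMeasure μ k, P (Fin.snoc (fun i => w i * g) (c * g)) := by
  have hsplit : ∀ᵐ g ∂μ, ∀ᵐ w ∂powMeasure μ k, P (Fin.snoc w g) :=
    Measure.ae_ae_of_ae_prod ((measurePreserving_snoc μ k).quasiMeasurePreserving.ae h)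
  filter_upwards [(measurePreserving_mul_left μ c).quasiMeasurePreserving.ae hsplit] with g hg
  exact (quasiMeasurePreserving_mul_right (powMeasure μ k) fun _ => g).ae hg

omit [MeasurableInv G] in
theorem measurable_snoc_mul (k b : ℕ) :
    Measurable fun q : G × (Fin k → G) × (Fin (b + 1) → G) =>
      (Fin.snoc (fun i => q.2.1 i * q.1) (q.2.2 0 * q.1) : Fin (k + 1) → G) := by
  refine measurable_pi_lambda _ fun i => ?_
  cases i using Fin.lastCases
  · simp only [Fin.snoc_last]; fun_prop
  · simp only [Fin.snoc_castSucc]; fun_prop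

/-- Generic right translation makes up for the last front variable being the first back one. -/
theorem ae_ae_alexanderWhitney {p k b : ℕ} (hp : p = k + b)
    {P : (Fin (k + 1) → G) → (Fin (b + 1) → G) → Prop} (hP : MeasurableSet {z : _ × _ | P z.1 z.2})
    (h : ∀ x, ∀ᵐ y ∂powMeasure μ (b + 1), P x y) :
    ∀ᵐ g ∂μ, ∀ᵐ z ∂powMeasure μ (p + 1), alexanderWhitney p (fun x => P fun i => x i * g) z := by
  subst hp
  let f : G → (Fin k → G) × (Fin (b + 1) → G) → Fin (k + 1) → G := fun g z =>
    Fin.snoc (fun i => z.1 i * g) (z.2 0 * g)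
  have hf : Measurable (Function.uncurry f) := measurable_snoc_mul k b
  have hmeas : MeasurableSet {q : (Fin (b + 1) → G) × G × (Fin k → G) |
      P (f q.2.1 (q.2.2, q.1)) q.1} := by
    have harg : Measurable fun q : (Fin (b + 1) → G) × G × (Fin k → G) =>
        (q.2.1, q.2.2, q.1) := by fun_prop
    exact ((hf.comp harg).prodMk measurable_fst) hP
  have hfixed : ∀ᵐ y ∂powMeasure μ (b + 1), ∀ᵐ x ∂powMeasure μ (k + 1), P x y :=
    (Measure.ae_ae_comm hP).1 (.of_forall h)
  have hback : ∀ᵐ y ∂powMeasure μ (b + 1), ∀ᵐ q ∂μ.prod (powMeasure μ k),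
      P (f q.1 (q.2, y)) y := by
    filter_upwards [hfixed] with y hy
    exact (Measure.ae_prod_iff_ae_ae (measurable_prodMk_left hmeas)).2
      (ae_ae_snoc_mul μ hy (y 0))
  have hfront : ∀ᵐ q ∂μ.prod (powMeasure μ k), ∀ᵐ y ∂powMeasure μ (b + 1),
      P (f q.1 (q.2, y)) y := (Measure.ae_ae_comm hmeas).1 hback
  filter_upwards [Measure.ae_ae_of_ae_prod hfront] with g hg
  have hmeas_g : MeasurableSet {v : (Fin k → G) × (Fin (b + 1) → G) | P (f g v) v.2} :=
    ((hf.comp measurable_prodMk_left).prodMk measurable_snd) hP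
  filter_upwards [(measurePreserving_castAdd_natAdd μ k (b + 1)).quasiMeasurePreserving.ae
    ((Measure.ae_prod_iff_ae_ae hmeas_g).2 hg)] with z hz
  have hsnoc : (fun i => (Fin.snoc (fun i => z (Fin.castAdd (b + 1) i))
      (z (Fin.natAdd k (0 : Fin (b + 1)))) : Fin (k + 1) → G) i * g) =
        f g (fun i => z (Fin.castAdd (b + 1) i), fun j => z (Fin.natAdd k j)) := by
    funext i
    cases i using Fin.lastCases <;> simp [f]
  rw [alexanderWhitney_eq_snoc, hsnoc]
  exact hz

end SplitMeasure

section Cohomologous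

variable {G : Type*} [Group G] [MeasurableSpace G] {μ : Measure G} {B : Type*} [AddCommGroup B]
  [MeasurableSpace B]

variable (μ) in
/-- Two functions on `G^(p+1)` differ almost everywhere by the coboundary of a measurable
equivariant function; in degree `0`, where there are no coboundaries, they agree almost
everywhere. -/
def IsCohomologous [SMul G B] (p : ℕ) (f f' : (Fin (p + 1) → G) → B) : Prop :=
  ∃ Q : (Fin p → G) → B, Measurable Q ∧ (∀ g x, Q (fun i => g * x i) = g • Q x) ∧
    (p = 0 → Q = 0) ∧ f =ᵐ[powMeasure μ (p + 1)] fun z => f' z + coboundary Q z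

variable [DistribMulAction G B] {p : ℕ} {f f' f'' : (Fin (p + 1) → G) → B}

theorem IsCohomologous.of_ae_eq (h : f =ᵐ[powMeasure μ (p + 1)] f') : IsCohomologous μ p f f' :=
  ⟨0, measurable_const, by simp, fun _ => rfl, h.trans (.of_eq (by simp [coboundary]))⟩

theorem IsCohomologous.trans [Countable B] [DiscreteMeasurableSpace B]
    (h : IsCohomologous μ p f f') (h' : IsCohomologous μ p f' f'') : IsCohomologous μ p f f'' := by
  obtain ⟨Q, hQm, hQe, hQ0, hQ⟩ := h
  obtain ⟨Q', hQm', hQe', hQ0', hQ'⟩ := h'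
  refine ⟨fun z => Q' z + Q z, hQm'.add hQm, fun g x => ?_, fun hp => ?_, ?_⟩
  · simp only [hQe, hQe', smul_add]
  · simp [hQ0 hp, hQ0' hp, Pi.zero_def]
  · filter_upwards [hQ, hQ'] with z hz hz'
    rw [hz, hz', coboundary_add, add_assoc]

variable [Countable B] [DiscreteMeasurableSpace B]

theorem isCohomologous_alexanderWhitney_coboundary [MeasurableMul G] {k b : ℕ}
    (hp : p = k + (b + 1)) {τ : (Fin (k + 1) → G) → (Fin (b + 1) → G) → B}
    (hm : Measurable (Function.uncurry τ))
    (he : ∀ g x y, τ (fun i => g * x i) (fun i => g * y i) = g • τ x y) (h : G) :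
    IsCohomologous μ p (alexanderWhitney p fun x => coboundary (τ fun i => x i * h))
      (alexanderWhitney p fun (x : Fin (k + 1 + 1) → G) y =>
        (-1 : ℤ) ^ (k + 1) • coboundary (fun x => τ x y) fun i => x i * h) := by
  obtain rfl : p = k + b + 1 := hp
  let φ : (Fin (k + 1) → G) → (Fin (b + 1) → G) → B := fun x => τ fun i => x i * h
  refine ⟨fun z => (-1 : ℤ) ^ k • alexanderWhitney (k + b) φ z, ?_, fun g x => ?_, by simp,
    .of_forall fun z => ?_⟩
  · have harg : Measurable fun z : Fin (k + b + 1) → G =>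
        ((fun i => z (Fin.ofNat _ i) * h, fun j => z (Fin.ofNat _ (k + j))) :
          (Fin (k + 1) → G) × (Fin (b + 1) → G)) := by fun_prop
    exact (measurable_of_countable fun b : B => _ • b).comp (hm.comp harg)
  · simp only [alexanderWhitney, φ, mul_assoc, he, smul_comm g]
  · dsimp only
    rw [coboundary_zsmul, coboundary_alexanderWhitney rfl, smul_add, smul_smul, ← pow_add,
      Even.neg_one_pow ⟨k, rfl⟩, one_smul]
    simp only [alexanderWhitney, φ, pow_succ, mul_neg_one, neg_smul]
    exact (neg_add_cancel_left _ _).symm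

end Cohomologous

section RegularComparison

variable {G : Type*} [Group G] [TopologicalSpace G] [IsTopologicalGroup G] [LocallyCompactSpace G]
  [SecondCountableTopology G] [MeasurableSpace G] [BorelSpace G] {μ : Measure G}
  [μ.IsHaarMeasure] {B : Type*} [AddCommGroup B] [Countable B] [MeasurableSpace B]
  [DiscreteMeasurableSpace B] {k b : ℕ} {φ : (Fin (k + 1) → G) → (Fin (b + 1) → G) → B}
  {τ : (Fin (k + 1) → G) → (Fin b → G) → B}

theorem ae_alexanderWhitney_ae_eq {p : ℕ} (hp : p = k + b) (hφ : Measurable (Function.uncurry φ))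
    (hτ : Measurable (Function.uncurry τ))
    (H : ∀ x, coboundary (τ x) =ᵐ[powMeasure μ (b + 1)] φ x) :
    ∀ᵐ h ∂μ, alexanderWhitney p (fun x => φ fun i => x i * h) =ᵐ[powMeasure μ (p + 1)]
      alexanderWhitney p fun x => coboundary (τ fun i => x i * h) := by
  have hm : Measurable fun z : (Fin (k + 1) → G) × (Fin (b + 1) → G) => coboundary (τ z.1) z.2 := by
    refine measurable_coboundary (f := fun z => τ z.1) (y := Prod.snd) fun i => ?_
    have hface : Measurable fun z : (Fin (k + 1) → G) × (Fin (b + 1) → G) =>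
        (z.1, fun j => z.2 (i.succAbove j)) := by fun_prop
    exact hτ.comp hface
  filter_upwards [ae_ae_alexanderWhitney μ hp (measurableSet_eq_fun hm hφ) H] with h hh
  exact hh.mono fun z hz => hz.symm

variable {𝒩 : ∀ q : ℕ, Set (Set (Fin q → G))} [T2Space G] [TopologicalSpace B] [DiscreteTopology B]
  [DistribMulAction G B] [ContinuousSMul G B]

/-- A primitive `τ` of `φ` in the back variables trades `φ` for the coboundary of `τ` in the front
variables, which has one front variable more and one back variable less. -/
theorem IsRegular.exists_isCohomologous (h𝒩 : IsTameSystem μ 𝒩) {p : ℕ} (hp : p = k + b)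
    (hφ : IsRegular μ 𝒩 φ) (h0 : ∀ x y, coboundary (fun x => φ x y) x = 0)
    (h1 : ∀ x, coboundary (φ x) =ᵐ[powMeasure μ (b + 2)] 0) :
    ∃ τ : (Fin (p + 1) → G) → (Fin 0 → G) → B, IsRegular μ 𝒩 τ ∧
      (∀ x, coboundary (fun x => τ x default) x = 0) ∧
      ∀ᵐ h ∂μ, IsCohomologous μ p (alexanderWhitney p fun x => φ fun i => x i * h)
        fun z => τ (fun i => z i * h) default := by
  induction b generalizing k with
  | zero =>
    obtain ⟨τ, hτ, H⟩ := hφ.exists_primitive h𝒩 h1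
    have hφτ := ae_alexanderWhitney_ae_eq hp hφ.measurable hτ.measurable H
    obtain rfl : p = k := hp
    have hconst (f : (Fin 0 → G) → B) (y : Fin 1 → G) : coboundary f y = f default := by
      simp [coboundary, Subsingleton.elim _ (default : Fin 0 → G)]
    refine ⟨τ, hτ, fun x => ?_, hφτ.mono fun h hh => .of_ae_eq (hh.trans (.of_eq ?_))⟩
    · obtain ⟨y, hy⟩ := (coboundary_coboundary_ae_eq_zero μ h0 H x).exists
      rwa [hconst] at hy
    · funext z
      simp [alexanderWhitney, hconst]
  | succ b ih =>
    obtain ⟨τ, hτ, H⟩ := hφ.exists_primitive h𝒩 h1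
    have hψ (x : Fin (k + 2) → G) : coboundary (fun y => (-1 : ℤ) ^ (k + 1) •
        coboundary (fun x => τ x y) x) =ᵐ[powMeasure μ (b + 2)] 0 := by
      filter_upwards [coboundary_coboundary_ae_eq_zero μ h0 H x] with y hy
      rw [coboundary_zsmul, hy, Pi.zero_apply, smul_zero]
    obtain ⟨τ', hτ', hτ'0, H'⟩ := ih (k := k + 1) (by omega)
      ((hτ.coboundary_left h𝒩).zsmul ((-1) ^ (k + 1)))
      (fun x y => by rw [coboundary_zsmul, coboundary_coboundary, smul_zero]) hψ
    refine ⟨τ', hτ', hτ'0, ?_⟩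
    filter_upwards [H', ae_alexanderWhitney_ae_eq hp hφ.measurable hτ.measurable H] with h hh' hh
    exact (IsCohomologous.of_ae_eq hh).trans
      ((isCohomologous_alexanderWhitney_coboundary hp hτ.measurable hτ.equivariant h).trans hh')

end RegularComparison

/-! ### Construction of tame systems -/

/-- A system of algebras of subsets of the powers of `G`, stable under the structure maps of the
homogeneous bar resolution, and containing small sublevel sets of continuous functions. In the
theorem it consists of all subsets, or of the semi-algebraic ones. -/
structure IsStableSystem {G : Type*} [Group G] [TopologicalSpace G]
    (𝒮 : ∀ q : ℕ, Set (Set (Fin q → G))) : Prop where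
  isSetAlgebra : ∀ q, IsSetAlgebra (𝒮 q)
  sublevel : ∀ q (x : Fin q → G), ∀ U ∈ 𝓝 x, ∃ f : (Fin q → G) → ℝ, Continuous f ∧ f x = 0 ∧
    (∀ r, {z | f z < r} ∈ 𝒮 q) ∧ ∃ ε > 0, {z | f z < ε} ⊆ U
  face : ∀ q (i : Fin (q + 1)), ∀ C ∈ 𝒮 q,
    (fun x : Fin (q + 1) → G => i.removeNth x) ⁻¹' C ∈ 𝒮 (q + 1)
  quot : ∀ q, ∀ C ∈ 𝒮 q,
    (fun (x : Fin (q + 1) → G) (j : Fin q) => (x 0)⁻¹ * x j.succ) ⁻¹' C ∈ 𝒮 (q + 1)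
  mul_right : ∀ q (h : G), ∀ C ∈ 𝒮 q, (fun (x : Fin q → G) j => x j * h) ⁻¹' C ∈ 𝒮 q

theorem isSetAlgebra_setOf_null_frontier {X : Type*} [TopologicalSpace X] [MeasurableSpace X]
    (ν : Measure X) {𝒮 : Set (Set X)} (h𝒮 : IsSetAlgebra 𝒮) :
    IsSetAlgebra {C | C ∈ 𝒮 ∧ MeasurableSet C ∧ ν (frontier C) = 0} where
  empty_mem := ⟨h𝒮.empty_mem, MeasurableSet.empty, by simp⟩
  compl_mem _ hC := ⟨h𝒮.compl_mem hC.1, hC.2.1.compl, by rw [frontier_compl]; exact hC.2.2⟩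
  union_mem C D hC hD := ⟨h𝒮.union_mem hC.1 hD.1, hC.2.1.union hD.2.1,
    measure_mono_null ((frontier_union_subset C D).trans (Set.union_subset_union
      Set.inter_subset_left Set.inter_subset_right)) (measure_union_null hC.2.2 hD.2.2)⟩

theorem null_frontier_preimage {X Y : Type*} [TopologicalSpace X] [TopologicalSpace Y]
    [MeasurableSpace X] [MeasurableSpace Y] {ν : Measure X} {l : Measure Y} {f : X → Y}
    (hf : Continuous f) (hq : Measure.QuasiMeasurePreserving f ν l) {C : Set Y}
    (hC : l (frontier C) = 0) : ν (frontier (f ⁻¹' C)) = 0 :=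
  measure_mono_null (hf.frontier_preimage_subset C) (hq.preimage_null hC)

theorem exists_measure_level_set_eq_zero {X : Type*} [MeasurableSpace X] (ν : Measure X)
    [SigmaFinite ν] {f : X → ℝ} (hf : Measurable f) {a b : ℝ} (hab : a < b) :
    ∃ r ∈ Set.Ioo a b, ν {x | f x = r} = 0 := by
  by_contra! h
  refine not_le.2 hab (Cardinal.Real.Ioo_countable_iff.1 ?_)
  exact (Measure.countable_meas_level_set_pos hf).mono fun r hr => pos_iff_ne_zero.2 (h r hr)

/-- The Borel sets with null frontier that belong to a given system. They form a tame system, to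
which the dimension shifting argument applies. -/
def nullFrontierSystem {G : Type*} [TopologicalSpace G] [MeasurableSpace G] (μ : Measure G)
    (𝒮 : ∀ q : ℕ, Set (Set (Fin q → G))) (q : ℕ) : Set (Set (Fin q → G)) :=
  {C | C ∈ 𝒮 q ∧ MeasurableSet C ∧ powMeasure μ q (frontier C) = 0}

theorem preimage_mem_nullFrontierSystem {G : Type*} [TopologicalSpace G] [MeasurableSpace G]
    {μ : Measure G} {𝒮 : ∀ q : ℕ, Set (Set (Fin q → G))} {m n : ℕ}
    {f : (Fin m → G) → Fin n → G} (hf : Continuous f)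
    (hq : Measure.QuasiMeasurePreserving f (powMeasure μ m) (powMeasure μ n))
    (h𝒮 : ∀ C ∈ 𝒮 n, f ⁻¹' C ∈ 𝒮 m) {C : Set (Fin n → G)} (hC : C ∈ nullFrontierSystem μ 𝒮 n) :
    f ⁻¹' C ∈ nullFrontierSystem μ 𝒮 m :=
  ⟨h𝒮 C hC.1, hq.measurable hC.2.1, null_frontier_preimage hf hq hC.2.2⟩

section System

variable {G : Type*} [Group G] [TopologicalSpace G] [IsTopologicalGroup G] [LocallyCompactSpace G]
  [SecondCountableTopology G] [MeasurableSpace G] [BorelSpace G] (μ : Measure G)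
  [μ.IsHaarMeasure]

theorem quasiMeasurePreserving_quot (q : ℕ) :
    Measure.QuasiMeasurePreserving (fun (x : Fin (q + 1) → G) (j : Fin q) => (x 0)⁻¹ * x j.succ)
      (powMeasure μ (q + 1)) (powMeasure μ q) := by
  have h : Measure.QuasiMeasurePreserving (fun (z : G × (Fin q → G)) j => z.1⁻¹ * z.2 j)
      (μ.prod (powMeasure μ q)) (powMeasure μ q) :=
    QuasiMeasurePreserving.prod_of_right (by fun_prop) (Eventually.of_forall fun g =>
      (measurePreserving_diag μ q g⁻¹).quasiMeasurePreserving)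
  exact h.comp
    (measurePreserving_piFinSuccAbove (fun _ : Fin (q + 1) => μ) 0).quasiMeasurePreserving

namespace IsStableSystem

variable {𝒮 : ∀ q : ℕ, Set (Set (Fin q → G))}

theorem isTopologicalSetAlgebra (h : IsStableSystem 𝒮) (q : ℕ) :
    IsTopologicalSetAlgebra (nullFrontierSystem μ 𝒮 q) where
  toIsSetAlgebra := isSetAlgebra_setOf_null_frontier _ (h.isSetAlgebra q)
  exists_isOpen_subset x U hU := by
    obtain ⟨f, hf, hfx, hf𝒮, ε, hε, hfU⟩ := h.sublevel q x U hU
    obtain ⟨r, hr, hr0⟩ := exists_measure_level_set_eq_zero (powMeasure μ q) hf.measurable hε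
    have hopen : IsOpen {z | f z < r} := isOpen_lt hf continuous_const
    refine ⟨{z | f z < r}, ⟨hf𝒮 r, hopen.measurableSet, ?_⟩, hopen, hfx.trans_lt hr.1,
      fun z hz => hfU (lt_trans hz hr.2)⟩
    exact measure_mono_null (frontier_lt_subset_eq hf continuous_const) hr0

theorem isTameSystem (h : IsStableSystem 𝒮) : IsTameSystem μ (nullFrontierSystem μ 𝒮) where
  isTopologicalSetAlgebra := h.isTopologicalSetAlgebra μ
  measurableSet _ _ hC := hC.2.1
  null_frontier _ _ hC := hC.2.2
  face q i _ hC := preimage_mem_nullFrontierSystem (by fun_prop)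
    (quasiMeasurePreserving_face μ q i) (h.face q i) hC
  quot q _ hC := preimage_mem_nullFrontierSystem (by fun_prop)
    (quasiMeasurePreserving_quot μ q) (h.quot q) hC
  mul_right q g _ hC := preimage_mem_nullFrontierSystem (by fun_prop)
    (quasiMeasurePreserving_mul_right (powMeasure μ q) fun _ => g) (h.mul_right q g) hC

end IsStableSystem

end System

/-! ### Functions constant on the level sets of a labelling -/

/-- `f` is constant on the members of a locally finite partition of `X` into sets from `𝒮`. For the
semi-algebraic sets this is `IsSemialgebraicallyPartitioned`. -/
def IsConstantOnPartition {X A : Type*} [TopologicalSpace X] (𝒮 : Set (Set X)) (f : X → A) : Prop :=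
  ∃ P : Set (Set X), Setoid.IsPartition P ∧ LocallyFinite (Subtype.val : P → Set X) ∧
    (∀ C ∈ P, C ∈ 𝒮) ∧ ∀ C ∈ P, ∀ x ∈ C, ∀ y ∈ C, f x = f y

theorem IsConstantOnPartition.mono {X A : Type*} [TopologicalSpace X] {𝒮 𝒯 : Set (Set X)}
    {f : X → A} (hf : IsConstantOnPartition 𝒮 f) (h : 𝒮 ⊆ 𝒯) : IsConstantOnPartition 𝒯 f :=
  let ⟨P, hP, hlf, hP𝒮, hPf⟩ := hf
  ⟨P, hP, hlf, fun C hC => h (hP𝒮 C hC), hPf⟩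

namespace IsLabel

variable {X A : Type*} [TopologicalSpace X] {𝒩 : Set (Set X)} {x₀ : X} {N : X → ℕ} {f : X → A}

theorem measure_not_eventually_eq [MeasurableSpace X] {ν : Measure X}
    (h𝒩 : ∀ C ∈ 𝒩, ν (frontier C) = 0) (hN : IsLabel 𝒩 x₀ N) :
    ν {x | ∀ᶠ y in 𝓝 x, N y = N x}ᶜ = 0 := by
  refine measure_mono_null (t := ⋃ n, frontier (N ⁻¹' {n})) (fun x hx => ?_)
    (measure_iUnion_null fun n => h𝒩 _ (hN.preimage_mem n))
  exact Set.mem_iUnion.2 ⟨N x, subset_closure rfl, fun h => hx (mem_interior_iff_mem_nhds.1 h)⟩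

theorem locallyConstantOnFullDenseOpen [MeasurableSpace X] {ν : Measure X} [ν.IsOpenPosMeasure]
    (h𝒩 : ∀ C ∈ 𝒩, ν (frontier C) = 0) (hN : IsLabel 𝒩 x₀ N) (hf : f.FactorsThrough N) :
    LocallyConstantOnFullDenseOpen ν f := by
  have h0 := hN.measure_not_eventually_eq h𝒩
  refine ⟨_, isOpen_iff_mem_nhds.2 fun x (hx : ∀ᶠ y in 𝓝 x, N y = N x) => ?_,
    Measure.dense_of_ae (ae_iff.2 h0), h0,
    fun x (hx : ∀ᶠ y in 𝓝 x, N y = N x) => hx.mono fun y hy => hf hy⟩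
  filter_upwards [hx.eventually_nhds, hx] with y h1 h2
  exact h1.mono fun z hz => hz.trans h2.symm

theorem isConstantOnPartition (hN : IsLabel 𝒩 x₀ N) (hf : f.FactorsThrough N) :
    IsConstantOnPartition 𝒩 f := by
  refine ⟨(Setoid.ker N).classes, Setoid.isPartition_classes _, fun x => ?_, ?_, ?_⟩
  · obtain ⟨U, hU, hNU⟩ := hN.locallyFiniteValued x
    refine ⟨U, hU, Set.Finite.of_injOn (f := Subtype.val) (t := (fun n => N ⁻¹' {n}) '' (N '' U))
      ?_ Subtype.val_injective.injOn (hNU.image _)⟩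
    rintro ⟨_, y, rfl⟩ ⟨z, hzy : N z = N y, hzU⟩
    exact ⟨N z, Set.mem_image_of_mem N hzU, by rw [hzy]; rfl⟩
  · rintro _ ⟨y, rfl⟩
    exact hN.preimage_mem (N y)
  · rintro _ ⟨y, rfl⟩ z (hz : N z = N y) z' (hz' : N z' = N y)
    exact hf (hz.trans hz'.symm)

end IsLabel

/-! ### Reduction to countable modules -/

theorem sum_neg_one_pow_sub_smul {α B : Type*} [AddCommGroup B] {q : ℕ} (f : (Fin q → α) → B)
    (x : Fin (q + 1) → α) :
    ∑ i : Fin (q + 1), (-1 : ℤ) ^ (q - (i : ℕ)) • f (fun j => x (i.succAbove j)) =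
      (-1 : ℤ) ^ q • coboundary f x := by
  rw [coboundary, Finset.smul_sum]
  refine Finset.sum_congr rfl fun i _ => ?_
  have hi : (-1 : ℤ) ^ q * (-1) ^ (i : ℕ) = (-1) ^ (q - (i : ℕ)) := by
    rw [← pow_add, show q + (i : ℕ) = q - i + 2 * i by lia, pow_add,
      Even.neg_one_pow (even_two_mul _), mul_one]
  rw [smul_smul, hi]
  rfl

theorem coboundary_map {α B A : Type*} [AddCommGroup B] [AddCommGroup A] {F : Type*}
    [FunLike F B A] [AddMonoidHomClass F B A] (ι : F) {n : ℕ} (f : (Fin n → α) → B)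
    (x : Fin (n + 1) → α) :
    coboundary (fun y => ι (f y)) x = ι (coboundary f x) := by
  simp only [coboundary, map_sum, map_zsmul]

/-- An everywhere equivariant cocycle that is constant near the origin and on the level sets of a
labelling: the representatives that the theorem asks for. -/
structure IsLabelledCocycle {G A : Type*} [Group G] [TopologicalSpace G] [AddCommGroup A]
    [SMul G A] (𝒩 : ∀ q : ℕ, Set (Set (Fin q → G))) {p : ℕ} (σ : (Fin (p + 1) → G) → A) :
    Prop where
  equivariant : ∀ (g : G) (x : Fin (p + 1) → G), σ (fun i => g * x i) = g • σ x
  coboundary_eq_zero : ∀ x, coboundary σ x = 0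
  eventually_eq : ∀ᶠ x in 𝓝 1, σ x = σ 1
  exists_isLabel : ∃ x₀ N, IsLabel (𝒩 (p + 1)) x₀ N ∧ σ.FactorsThrough N

theorem IsLabelledCocycle.map {G A B : Type*} [Group G] [TopologicalSpace G] [AddCommGroup A]
    [DistribMulAction G A] [AddCommGroup B] [DistribMulAction G B]
    {𝒩 : ∀ q : ℕ, Set (Set (Fin q → G))} {p : ℕ} {σ : (Fin (p + 1) → G) → B}
    (h : IsLabelledCocycle 𝒩 σ) (ι : B →+[G] A) : IsLabelledCocycle 𝒩 fun x => ι (σ x) where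
  equivariant g x := by rw [h.equivariant, map_smul]
  coboundary_eq_zero x := by rw [coboundary_map, h.coboundary_eq_zero, map_zero]
  eventually_eq := h.eventually_eq.mono fun x hx => congrArg ι hx
  exists_isLabel :=
    let ⟨x₀, N, hN, hσ⟩ := h.exists_isLabel
    ⟨x₀, N, hN, fun _ _ hx => congrArg ι (hσ hx)⟩

theorem IsTame.exists_isLabel_factorsThrough {X Y B : Type*} [TopologicalSpace X]
    [MeasurableSpace Y] [Unique Y] {ν : Measure Y} [NeZero ν] {𝒩 : Set (Set X)} {x₀ : X}
    {φ : X → Y → B} (h : IsTame 𝒩 x₀ ν φ) :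
    ∃ N, IsLabel 𝒩 x₀ N ∧ (fun x => φ x default).FactorsThrough N := by
  have hν : ν Set.univ ≠ 0 := NeZero.ne _
  obtain ⟨ε, hε, hεν⟩ := exists_between (pos_iff_ne_zero.2 hν)
  obtain ⟨N, hN, hφ⟩ := h ε hε.ne'
  refine ⟨N, hN, fun x x' hx => ?_⟩
  by_contra hne
  have huniv : {y | φ x y ≠ φ x' y} = Set.univ :=
    Set.eq_univ_of_forall fun y => by rwa [Unique.eq_default y]
  exact (hφ x x' hx).not_gt (huniv ▸ hεν)

theorem eventually_mul_right_eq_of_equivariant {G B : Type*} [Group G] [TopologicalSpace G]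
    [IsTopologicalGroup G] [SMul G B] {q : ℕ} {τ : (Fin q → G) → B}
    (he : ∀ g x, τ (fun i => g * x i) = g • τ x) (h1 : ∀ᶠ x in 𝓝 1, τ x = τ 1) (h : G) :
    ∀ᶠ x in 𝓝 (1 : Fin q → G), τ (fun i => x i * h) = τ fun i => (1 : Fin q → G) i * h := by
  have hconj (w : Fin q → G) : τ (fun i => w i * h) = h • τ fun i => h⁻¹ * (w i * h) := by
    rw [← he]; simp only [mul_inv_cancel_left]
  have hcont : Continuous fun (w : Fin q → G) i => h⁻¹ * (w i * h) := by fun_prop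
  have hone : (fun i => h⁻¹ * ((1 : Fin q → G) i * h)) = 1 := by ext; simp
  filter_upwards [hcont.continuousAt.eventually (hone.symm ▸ h1)] with x hx
  rw [hconj x, hconj 1, hx, hone]

section Reduction

variable {G : Type*} [Group G] [TopologicalSpace G] [IsTopologicalGroup G]
  [SecondCountableTopology G] [MeasurableSpace G] [BorelSpace G] {μ : Measure G} {B : Type*}
  [AddCommGroup B] [Countable B] [TopologicalSpace B] [DiscreteTopology B] [MeasurableSpace B]
  [DiscreteMeasurableSpace B] [DistribMulAction G B] [ContinuousSMul G B]

/-- For almost every `g` the equivariant function `x ↦ x₀ g⁻¹ • s (g x₀⁻¹ x)` is almost everywhere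
equal to `s`. -/
theorem exists_equivariant_ae_eq [μ.IsMulLeftInvariant] [SigmaFinite μ] [NeZero μ] {p : ℕ}
    {s : (Fin (p + 1) → G) → B} (hs : Measurable s)
    (h : ∀ g : G, ∀ᵐ x ∂powMeasure μ (p + 1), g • s (fun i => g⁻¹ * x i) = s x) :
    ∃ σ : (Fin (p + 1) → G) → B, Measurable σ ∧ (∀ g x, σ (fun i => g * x i) = g • σ x) ∧
      σ =ᵐ[powMeasure μ (p + 1)] s := by
  let f : G × (Fin (p + 1) → G) → B := fun z => z.1 • s fun i => z.1⁻¹ * z.2 i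
  have hf : Measurable f :=
    measurable_smul_of_countable.comp (measurable_fst.prodMk (hs.comp (by fun_prop)))
  have hS : MeasurableSet {z : G × (Fin (p + 1) → G) | f z = s z.2} :=
    measurableSet_eq_fun hf (hs.comp measurable_snd)
  have hm : Measurable fun z : (Fin (p + 1) → G) × G => (z.1 0 * z.2⁻¹, z.1) := by fun_prop
  have h_all : ∀ᵐ x ∂powMeasure μ (p + 1), ∀ᵐ g ∂μ, f (g, x) = s x :=
    (Measure.ae_ae_comm (p := fun g x => f (g, x) = s x) hS).1 (Eventually.of_forall h)
  have h_translate : ∀ᵐ x ∂powMeasure μ (p + 1), ∀ᵐ g ∂μ, f (x 0 * g⁻¹, x) = s x := by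
    filter_upwards [h_all] with x hx
    exact ((measurePreserving_mul_left μ (x 0)).quasiMeasurePreserving.comp
      (quasiMeasurePreserving_inv μ)).ae hx
  obtain ⟨g, hg⟩ := ((Measure.ae_ae_comm (p := fun x g => f (x 0 * g⁻¹, x) = s x) (hm hS)).1
    h_translate).exists
  refine ⟨fun x => f (x 0 * g⁻¹, x), hf.comp (hm.comp measurable_prodMk_right), fun k x => ?_, hg⟩
  simp only [f, mul_inv_rev, mul_smul, mul_assoc, inv_mul_cancel_left]

theorem exists_isLabelledCocycle_isCohomologous [LocallyCompactSpace G] [T2Space G]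
    [μ.IsHaarMeasure] {𝒩 : ∀ q : ℕ, Set (Set (Fin q → G))}
    (h𝒩 : IsTameSystem μ 𝒩) {p : ℕ} {σ : (Fin (p + 1) → G) → B} (hm : Measurable σ)
    (he : ∀ g x, σ (fun i => g * x i) = g • σ x)
    (h0 : coboundary σ =ᵐ[powMeasure μ (p + 2)] 0) :
    ∃ σ' : (Fin (p + 1) → G) → B, IsLabelledCocycle 𝒩 σ' ∧ IsCohomologous μ p σ σ' := by
  have hσ : IsRegular μ 𝒩 fun (_ : Fin (0 + 1) → G) (y : Fin (p + 1) → G) => σ y :=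
    { equivariant := fun g _ y => he g y
      measurable := hm.comp measurable_snd
      tame := IsTame.const (h𝒩.isSetAlgebra _) _
      tame_slice := IsTame.const (h𝒩.isSetAlgebra _) _ }
  obtain ⟨τ, hτ, hτ0, H⟩ := hσ.exists_isCohomologous h𝒩 (Nat.zero_add p).symm
    (fun x y => by simp [coboundary, Fin.sum_univ_two]) fun _ => h0
  obtain ⟨h, hh⟩ := H.exists
  obtain ⟨N, hN, hNτ⟩ := hτ.tame.exists_isLabel_factorsThrough
  have hτe : ∀ g x, τ (fun i => g * x i) default = g • τ x default := fun g x => by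
    rw [← hτ.equivariant, Subsingleton.elim (fun i => g * (default : Fin 0 → G) i) default]
  refine ⟨fun z => τ (fun i => z i * h) default, ⟨fun g x => ?_, fun x => hτ0 fun i => x i * h,
    eventually_mul_right_eq_of_equivariant hτe (hN.eventually_eq.mono fun x hx => hNτ hx) h,
    fun _ => h⁻¹, fun z => N fun i => z i * h, ?_, fun x x' hx => hNτ hx⟩, ?_⟩
  · simp only [mul_assoc, hτe]
  · exact hN.comp (f := fun (z : Fin (p + 1) → G) i => z i * h) (by fun_prop)
      (h𝒩.mul_right _ h) (by ext; simp)
  · convert hh using 1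
    funext z
    simp [alexanderWhitney]

end Reduction

theorem measurable_of_injective_comp {X A B : Type*} [MeasurableSpace X] [TopologicalSpace A]
    [DiscreteTopology A] [Countable B] [MeasurableSpace B] {ι : B → A}
    (hι : Function.Injective ι) {s : X → B} (hs : StronglyMeasurable fun x => ι (s x)) :
    Measurable s := by
  borelize A
  refine measurable_to_countable' fun b => ?_
  have h := hs.measurable (isClosed_discrete {ι b}).measurableSet
  convert h using 1
  ext x
  exact hι.eq_iff.symm

section Classes

variable {G : Type*} [Group G] [TopologicalSpace G] [IsTopologicalGroup G] [MeasurableSpace G]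
  [BorelSpace G] {μ : Measure G} [SigmaFinite μ] {A : Type*} [AddCommGroup A]
  [TopologicalSpace A] [IsTopologicalAddGroup A]

theorem coeFn_d (q : ℕ) (φ : Cochain μ A q) :
    ⇑(d μ A q φ) =ᵐ[powMeasure μ (q + 1)] fun x => (-1 : ℤ) ^ q • coboundary φ x := by
  rw [d_apply]
  filter_upwards [AEEqFun.coeFn_fun_finsetSum Finset.univ fun i : Fin (q + 1) =>
      (-1 : ℤ) ^ (q - (i : ℕ)) • face μ A q i φ,
    ae_all_iff.2 fun i : Fin (q + 1) =>
      AEEqFun.coeFn_smul ((-1 : ℤ) ^ (q - (i : ℕ))) (face μ A q i φ),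
    ae_all_iff.2 fun i => coeFn_face μ A q i φ] with x hsum hsmul hface
  rw [hsum, ← sum_neg_one_pow_sub_smul]
  exact Finset.sum_congr rfl fun i _ => by rw [hsmul, Pi.smul_apply, hface]

theorem coboundary_ae_eq_zero {q : ℕ} {φ : Cochain μ A q} (h : d μ A q φ = 0) :
    coboundary φ =ᵐ[powMeasure μ (q + 1)] 0 := by
  filter_upwards [h ▸ coeFn_d q φ, AEEqFun.coeFn_zero (μ := powMeasure μ (q + 1)) (β := A)]
    with x hd h0
  rwa [h0, Pi.zero_apply, eq_comm, ((isUnit_one.neg).pow q).smul_eq_zero] at hd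

variable [μ.IsMulLeftInvariant] [DistribMulAction G A] [ContinuousSMul G A]

theorem mk_mem_invariants {q : ℕ} {Q : (Fin q → G) → A}
    (hQ : AEStronglyMeasurable Q (powMeasure μ q))
    (he : ∀ g x, Q (fun i => g * x i) = g • Q x) : AEEqFun.mk Q hQ ∈ invariants μ A q := by
  refine (mem_invariants μ A _ _).2 fun g => AEEqFun.ext ((coeFn_act μ A _ _ _).trans ?_)
  have hmk := AEEqFun.coeFn_mk Q hQ
  filter_upwards [hmk,
    (measurePreserving_diag μ q g⁻¹).quasiMeasurePreserving.ae hmk] with x hx hgx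
  rw [hx, hgx, he, smul_inv_smul]

theorem exists_mem_coboundaries_ae_eq {p : ℕ} {Q : (Fin p → G) → A}
    (hQ : AEStronglyMeasurable Q (powMeasure μ p)) (he : ∀ g x, Q (fun i => g * x i) = g • Q x)
    (h0 : p = 0 → Q = 0) :
    ∃ w ∈ coboundaries μ A p, w =ᵐ[powMeasure μ (p + 1)] coboundary Q := by
  cases p with
  | zero =>
    refine ⟨0, zero_mem _, AEEqFun.coeFn_zero.trans (.of_eq ?_)⟩
    ext x
    simp [coboundary, h0 rfl]
  | succ q =>
    have hmk := mk_mem_invariants hQ he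
    refine ⟨d μ A (q + 1) ((-1 : ℤ) ^ (q + 1) • AEEqFun.mk Q hQ),
      ⟨_, zsmul_mem hmk _, rfl⟩, ?_⟩
    rw [map_zsmul]
    filter_upwards [AEEqFun.coeFn_smul ((-1 : ℤ) ^ (q + 1)) (d μ A (q + 1) (AEEqFun.mk Q hQ)),
      coeFn_d (q + 1) (AEEqFun.mk Q hQ), coboundary_ae_congr μ (AEEqFun.coeFn_mk Q hQ)]
      with x h1 h2 h3
    rw [h1, Pi.smul_apply, h2, h3, smul_smul, ← mul_pow, neg_one_mul, neg_neg, one_pow, one_smul]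

theorem represents_of_ae_eq_add_coboundary {p : ℕ} (z : cocycles μ A p)
    {σ : (Fin (p + 1) → G) → A} (hσ : ∀ g x, σ (fun i => g * x i) = g • σ x)
    (hσ0 : ∀ x, coboundary σ x = 0) {Q : (Fin p → G) → A}
    (hQ : AEStronglyMeasurable Q (powMeasure μ p)) (he : ∀ g x, Q (fun i => g * x i) = g • Q x)
    (h0 : p = 0 → Q = 0)
    (hz : (z : Cochain μ A (p + 1)) =ᵐ[powMeasure μ (p + 1)] fun x => σ x + coboundary Q x) :
    Represents μ (QuotientAddGroup.mk z : Hm μ A p) σ := by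
  obtain ⟨w, hw, hwQ⟩ := exists_mem_coboundaries_ae_eq hQ he h0
  refine ⟨hσ, fun x => by rw [sum_neg_one_pow_sub_smul, hσ0, smul_zero],
    z - ⟨w, coboundaries_le_cocycles μ A p hw⟩, ?_, ?_⟩
  · refine QuotientAddGroup.eq.2 (AddSubgroup.mem_addSubgroupOf.2 ?_)
    simpa using hw
  · refine (AEEqFun.coeFn_sub (z : Cochain μ A (p + 1)) w).trans ?_
    filter_upwards [hz, hwQ] with x hzx hwx
    rw [Pi.sub_apply, hzx, hwx, add_sub_cancel_right]

end Classes

section CountableModule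

variable {G : Type*} [Group G] [TopologicalSpace G] [IsTopologicalGroup G]
  [SecondCountableTopology G] [MeasurableSpace G] [BorelSpace G] {μ : Measure G}
  {A : Type*} [AddCommGroup A] [TopologicalSpace A] [DiscreteTopology A] [DistribMulAction G A]
  [ContinuousSMul G A] {B : Type*} [AddCommGroup B] [Countable B] [TopologicalSpace B]
  [DiscreteTopology B] [DistribMulAction G B] [ContinuousSMul G B] [MeasurableSpace B]
  [DiscreteMeasurableSpace B]

theorem exists_measurable_equivariant_ae_eq [μ.IsMulLeftInvariant] [SigmaFinite μ] [NeZero μ]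
    {ι : B →+[G] A} (hι : Function.Injective ι) {p : ℕ} (z : cocycles μ A p)
    (hz : Set.range (z : Cochain μ A (p + 1)) ⊆ Set.range ι) :
    ∃ s : (Fin (p + 1) → G) → B, Measurable s ∧ (∀ g x, s (fun i => g * x i) = g • s x) ∧
      coboundary s =ᵐ[powMeasure μ (p + 2)] 0 ∧
      (z : Cochain μ A (p + 1)) =ᵐ[powMeasure μ (p + 1)] fun x => ι (s x) := by
  obtain ⟨z, hz_inv, hz_d⟩ := z
  choose s hs using fun x => hz (Set.mem_range_self x)
  have hsm : Measurable s :=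
    measurable_of_injective_comp hι (by simpa only [hs] using z.stronglyMeasurable)
  obtain ⟨σ, hσm, hσe, hσs⟩ := exists_equivariant_ae_eq (μ := μ) hsm fun g => by
    have hact := coeFn_act μ A (p + 1) g z
    rw [(mem_invariants μ A _ z).1 hz_inv g] at hact
    filter_upwards [hact] with x hx
    refine hι ?_
    rw [map_smul, hs, hs]
    exact hx.symm
  have hzσ : z =ᵐ[powMeasure μ (p + 1)] fun x => ι (σ x) := by
    filter_upwards [hσs] with x hx
    rw [hx, hs]
  refine ⟨σ, hσm, hσe, ?_, hzσ⟩
  filter_upwards [coboundary_ae_congr μ hzσ, coboundary_ae_eq_zero hz_d] with x hx hx0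
  exact hι (by rw [← coboundary_map, ← hx, hx0, Pi.zero_apply, Pi.zero_apply, map_zero])

theorem exists_isLabelledCocycle_represents_of_injective [LocallyCompactSpace G] [T2Space G]
    [μ.IsHaarMeasure] {𝒩 : ∀ q : ℕ, Set (Set (Fin q → G))} (h𝒩 : IsTameSystem μ 𝒩) {ι : B →+[G] A}
    (hι : Function.Injective ι) {p : ℕ} (z : cocycles μ A p)
    (hz : Set.range (z : Cochain μ A (p + 1)) ⊆ Set.range ι) :
    ∃ σ : (Fin (p + 1) → G) → A,
      IsLabelledCocycle 𝒩 σ ∧ Represents μ (QuotientAddGroup.mk z : Hm μ A p) σ := by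
  obtain ⟨s, hsm, hse, hs0, hzs⟩ := exists_measurable_equivariant_ae_eq hι z hz
  obtain ⟨σ, hσ, Q, hQm, hQe, hQ0, hsσ⟩ :=
    exists_isLabelledCocycle_isCohomologous h𝒩 hsm hse hs0
  have hQ : AEStronglyMeasurable (fun x => ι (Q x)) (powMeasure μ p) :=
    (StronglyMeasurable.of_discrete.comp_measurable hQm).aestronglyMeasurable
  refine ⟨_, hσ.map ι, represents_of_ae_eq_add_coboundary z (hσ.map ι).equivariant
    (hσ.map ι).coboundary_eq_zero hQ (fun g x => by rw [hQe, map_smul])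
    (fun hp => by rw [hQ0 hp]; exact funext fun _ => map_zero ι) ?_⟩
  filter_upwards [hzs, hsσ] with x hx hx'
  rw [hx, hx', map_add, coboundary_map]

end CountableModule

theorem countable_of_isSeparable {X : Type*} [TopologicalSpace X] [DiscreteTopology X] {s : Set X}
    (hs : TopologicalSpace.IsSeparable s) : s.Countable := by
  obtain ⟨c, hc, hsc⟩ := hs
  rw [closure_discrete] at hsc
  exact hc.mono hsc

section Represents

variable {G : Type*} [Group G] [TopologicalSpace G] [SecondCountableTopology G]
  {A : Type*} [AddCommGroup A] [TopologicalSpace A] [DiscreteTopology A]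
  [DistribMulAction G A] [ContinuousSMul G A]

variable (G) in
theorem exists_countable_submodule {s : Set A} (hs : TopologicalSpace.IsSeparable s) :
    ∃ M : Submodule ℤ A, Countable M ∧ s ⊆ M ∧ ∀ g : G, ∀ a ∈ M, g • a ∈ M := by
  let S : Set A := (fun z : G × A => z.1 • z.2) '' Set.univ ×ˢ s
  have hS : TopologicalSpace.IsSeparable S :=
    ((TopologicalSpace.IsSeparable.of_separableSpace _).prod hs).image continuous_smul
  have hSG (g : G) : ∀ a ∈ S, g • a ∈ S := by
    rintro _ ⟨⟨k, a⟩, ⟨-, ha⟩, rfl⟩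
    exact ⟨(g * k, a), ⟨trivial, ha⟩, mul_smul g k a⟩
  refine ⟨Submodule.span ℤ S, (countable_of_isSeparable hS.span).to_subtype,
    fun a ha => Submodule.subset_span ⟨(1, a), ⟨trivial, ha⟩, one_smul G a⟩, fun g a ha => ?_⟩
  have hmap : Submodule.span ℤ S ≤
      (Submodule.span ℤ S).comap (DistribSMul.toAddMonoidHom A g).toIntLinearMap :=
    Submodule.span_le.2 fun a ha => Submodule.subset_span (hSG g a ha)
  exact hmap ha

theorem exists_isLabelledCocycle_represents [IsTopologicalGroup G] [LocallyCompactSpace G]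
    [T2Space G] [MeasurableSpace G] [BorelSpace G] {μ : Measure G} [μ.IsHaarMeasure]
    {𝒩 : ∀ q : ℕ, Set (Set (Fin q → G))}
    (h𝒩 : IsTameSystem μ 𝒩) {p : ℕ} (c : Hm μ A p) :
    ∃ σ : (Fin (p + 1) → G) → A, IsLabelledCocycle 𝒩 σ ∧ Represents μ c σ := by
  obtain ⟨z, rfl⟩ := QuotientAddGroup.mk_surjective c
  obtain ⟨M, hM, hzM, hMG⟩ := exists_countable_submodule G
    (z : Cochain μ A (p + 1)).stronglyMeasurable.isSeparable_range
  let _ : DistribMulAction G M :=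
    { smul := fun g a => ⟨g • (a : A), hMG g a a.2⟩
      one_smul := fun a => Subtype.ext (one_smul G (a : A))
      mul_smul := fun g h a => Subtype.ext (mul_smul g h (a : A))
      smul_zero := fun g => Subtype.ext (smul_zero g)
      smul_add := fun g a b => Subtype.ext (smul_add g (a : A) b) }
  have : ContinuousSMul G M :=
    ⟨(continuous_fst.smul (continuous_subtype_val.comp continuous_snd)).subtype_mk _⟩
  let ι : M →+[G] A := { M.subtype.toAddMonoidHom with map_smul' := fun _ _ => rfl }
  let _ : MeasurableSpace M := ⊤
  have : DiscreteMeasurableSpace M := ⟨fun _ => trivial⟩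
  exact exists_isLabelledCocycle_represents_of_injective h𝒩 (ι := ι) Subtype.val_injective z
    (hzM.trans_eq Subtype.range_coe.symm)

theorem IsStableSystem.exists_represents [IsTopologicalGroup G] [LocallyCompactSpace G]
    [T2Space G] [MeasurableSpace G] [BorelSpace G] {μ : Measure G} [μ.IsHaarMeasure]
    {𝒮 : ∀ q : ℕ, Set (Set (Fin q → G))}
    (h𝒮 : IsStableSystem 𝒮) {p : ℕ} (c : Hm μ A p) :
    ∃ σ : (Fin (p + 1) → G) → A, Represents μ c σ ∧ LocallyFiniteValued σ ∧
      LocallyConstantOnFullDenseOpen (powMeasure μ (p + 1)) σ ∧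
      IsConstantOnPartition (𝒮 (p + 1)) σ ∧ ∀ᶠ x in 𝓝 1, σ x = σ 1 := by
  have h𝒩 := h𝒮.isTameSystem μ
  obtain ⟨σ, hσ, hσc⟩ := exists_isLabelledCocycle_represents h𝒩 c
  obtain ⟨x₀, N, hN, hNσ⟩ := hσ.exists_isLabel
  exact ⟨σ, hσc, hN.locallyFiniteValued.of_factorsThrough hNσ,
    hN.locallyConstantOnFullDenseOpen (h𝒩.null_frontier _) hNσ,
    (hN.isConstantOnPartition hNσ).mono fun _ hC => hC.1, hσ.eventually_eq⟩

end Represents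

theorem isStableSystem_univ {G : Type*} [Group G] [TopologicalSpace G]
    [TopologicalSpace.MetrizableSpace G] :
    IsStableSystem fun q => (Set.univ : Set (Set (Fin q → G))) where
  isSetAlgebra _ := ⟨trivial, fun _ _ => trivial, fun _ _ _ _ => trivial⟩
  sublevel q x U hU := by
    let _ : MetricSpace (Fin q → G) := TopologicalSpace.metrizableSpaceMetric _
    obtain ⟨ε, hε, h⟩ := Metric.mem_nhds_iff.1 hU
    exact ⟨fun z => dist z x, by fun_prop, dist_self x, fun _ => trivial, ε, hε, h⟩
  face _ _ _ _ := trivial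
  quot _ _ _ := trivial
  mul_right _ _ _ _ := trivial

end MooreCohomology

/-! ### Semi-algebraic sets -/

section Semialgebraic

open MvPolynomial

variable {ι κ : Type*}

theorem isSetAlgebra_isSemialgebraic :
    IsSetAlgebra {S : Set (ι → ℝ) | IsSemialgebraic S} where
  empty_mem := by simpa using IsSemialgebraic.pos (ι := ι) 0
  compl_mem _ hS := IsSemialgebraic.compl hS
  union_mem S T hS hT := by
    have h : IsSemialgebraic (Sᶜ ∩ Tᶜ)ᶜ := (hS.compl.inter hT.compl).compl
    rwa [← Set.compl_union, compl_compl] at h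

theorem isSemialgebraic_setOf_eval_eq_zero (f : MvPolynomial ι ℝ) :
    IsSemialgebraic {x | eval x f = 0} := by
  convert (IsSemialgebraic.pos f).compl.inter (IsSemialgebraic.pos (-f)).compl
  ext x
  simp only [map_neg, Left.neg_pos_iff, Set.mem_inter_iff, Set.mem_compl_iff, Set.mem_ofPred_eq,
    not_lt]
  exact le_antisymm_iff

theorem isSemialgebraic_setOf_forall_eval_eq_zero [Finite ι] (S : Set (MvPolynomial ι ℝ)) :
    IsSemialgebraic {x | ∀ f ∈ S, eval x f = 0} := by
  obtain ⟨s, hsS, hs⟩ := (Submodule.fg_span_iff_fg_span_finset_subset S).1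
    (IsNoetherian.noetherian (Submodule.span (MvPolynomial ι ℝ) S))
  have h : {x | ∀ f ∈ S, eval x f = 0} = ⋂ f ∈ s, {x | eval x f = 0} := by
    ext x
    simp only [Set.mem_iInter, Set.mem_ofPred_eq]
    refine ⟨fun hx f hf => hx f (hsS hf), fun hx f hf => ?_⟩
    have hker : Submodule.span _ (s : Set (MvPolynomial ι ℝ)) ≤ RingHom.ker (eval x) :=
      Submodule.span_le.2 hx
    exact hker (hs ▸ Submodule.subset_span hf)
  rw [h]
  exact isSetAlgebra_isSemialgebraic.biInter_mem s fun f _ => isSemialgebraic_setOf_eval_eq_zero f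

theorem isSemialgebraic_setOf_sum_sq_lt [Fintype ι] (a : ι → ℝ) (r : ℝ) :
    IsSemialgebraic {x | ∑ k, (x k - a k) ^ 2 < r} := by
  convert IsSemialgebraic.pos (C r - ∑ k, (X k - C (a k)) ^ 2) using 1
  ext x
  simp

theorem exists_setOf_sum_sq_lt_subset [Fintype ι] {a : ι → ℝ} {U : Set (ι → ℝ)} (hU : U ∈ 𝓝 a) :
    ∃ ε > 0, {x | ∑ k, (x k - a k) ^ 2 < ε} ⊆ U := by
  obtain ⟨ε, hε, hεU⟩ := Metric.mem_nhds_iff.1 hU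
  refine ⟨ε ^ 2, by positivity, fun x hx => hεU ?_⟩
  rw [Metric.mem_ball, dist_pi_lt_iff hε]
  intro k
  rw [Real.dist_eq]
  refine abs_lt_of_sq_lt_sq (lt_of_le_of_lt ?_ hx) hε.le
  exact Finset.single_le_sum (f := fun k => (x k - a k) ^ 2) (fun _ _ => sq_nonneg _)
    (Finset.mem_univ k)

theorem IsSemialgebraic.preimage_comp {S : Set (ι → ℝ)} (hS : IsSemialgebraic S) (e : ι → κ) :
    IsSemialgebraic ((fun x : κ → ℝ => x ∘ e) ⁻¹' S) := by
  induction hS with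
  | pos f =>
    have h := IsSemialgebraic.pos (rename e f)
    simp only [eval_rename] at h
    exact h
  | compl _ ih => exact ih.compl
  | inter _ _ ihS ihT => exact ihS.inter ihT

theorem exists_pow_mul_eval_div {K : Type*} [Field K] (r : ι → MvPolynomial κ K)
    (D : MvPolynomial κ K) (f : MvPolynomial ι K) :
    ∃ (N : ℕ) (g : MvPolynomial κ K), ∀ x, eval x D ≠ 0 →
      eval x D ^ N * eval (fun i => eval x (r i) / eval x D) f = eval x g := by
  induction f using MvPolynomial.induction_on with
  | C a => exact ⟨0, C a, fun x _ => by simp only [pow_zero, one_mul, eval_C]⟩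
  | add f g hf hg =>
    obtain ⟨N, u, hu⟩ := hf
    obtain ⟨M, v, hv⟩ := hg
    refine ⟨N + M, D ^ M * u + D ^ N * v, fun x hx => ?_⟩
    simp only [map_add, map_mul, map_pow, ← hu x hx, ← hv x hx]
    ring
  | mul_X f i hf =>
    obtain ⟨N, u, hu⟩ := hf
    refine ⟨N + 1, u * r i, fun x hx => ?_⟩
    simp only [map_mul, ← hu x hx, eval_X]
    field_simp
    ring

theorem IsSemialgebraic.exists_preimage_div {S : Set (ι → ℝ)} (hS : IsSemialgebraic S)
    (r : ι → MvPolynomial κ ℝ) (D : MvPolynomial κ ℝ) :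
    ∃ T, IsSemialgebraic T ∧ ∀ x, eval x D ≠ 0 →
      (x ∈ T ↔ (fun i => eval x (r i) / eval x D) ∈ S) := by
  induction hS with
  | pos f =>
    obtain ⟨N, g, hg⟩ := exists_pow_mul_eval_div r D f
    refine ⟨_, IsSemialgebraic.pos (D ^ N * g), fun x hx => ?_⟩
    simp only [Set.mem_ofPred_eq, map_mul, map_pow, ← hg x hx]
    rw [← mul_assoc, ← mul_pow]
    exact mul_pos_iff_of_pos_left (pow_pos (mul_self_pos.2 hx) N)
  | compl _ ih =>
    obtain ⟨T, hT, h⟩ := ih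
    exact ⟨_, hT.compl, fun x hx => not_congr (h x hx)⟩
  | inter _ _ ih ih' =>
    obtain ⟨T, hT, h⟩ := ih
    obtain ⟨T', hT', h'⟩ := ih'
    exact ⟨_, hT.inter hT', fun x hx => and_congr (h x hx) (h' x hx)⟩

end Semialgebraic

/-! ### Matrix groups -/

section MatrixGroup

open MvPolynomial

theorem det_smul_inv_mul_eq_adjugate_mul {n R : Type*} [Fintype n] [DecidableEq n] [CommRing R]
    (u : (Matrix n n R)ˣ) (B : Matrix n n R) :
    (u : Matrix n n R).det • (((u⁻¹ : (Matrix n n R)ˣ) : Matrix n n R) * B) =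
      (u : Matrix n n R).adjugate * B := by
  rw [← Matrix.smul_mul, ← Matrix.one_mul (((u⁻¹ : (Matrix n n R)ˣ) : Matrix n n R)),
    ← Matrix.smul_mul, ← Matrix.adjugate_mul, Matrix.mul_assoc (Matrix.adjugate _), u.mul_inv,
    Matrix.mul_one]

variable {n : ℕ}

theorem IsAlgebraicSubgroup.isSemialgebraic_image {H : Subgroup (GL (Fin n) ℝ)}
    (hH : IsAlgebraicSubgroup H) :
    IsSemialgebraic ((fun (g : GL (Fin n) ℝ) (k : Fin n × Fin n) => g k.1 k.2) '' H) := by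
  obtain ⟨S, hS⟩ := hH
  convert (isSemialgebraic_setOf_eval_eq_zero
    (Matrix.mvPolynomialX (Fin n) (Fin n) ℝ).det).compl.inter
    (isSemialgebraic_setOf_forall_eval_eq_zero S)
  ext w
  have hdet : eval w (Matrix.mvPolynomialX (Fin n) (Fin n) ℝ).det =
      (Matrix.of fun i j => w (i, j)).det := by
    rw [RingHom.map_det]
    exact congrArg Matrix.det (Matrix.mvPolynomialX_mapMatrix_eval (Matrix.of fun i j => w (i, j)))
  simp only [Set.mem_inter_iff, Set.mem_compl_iff, Set.mem_ofPred_eq, hdet]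
  constructor
  · rintro ⟨g, hg, rfl⟩
    exact ⟨((Matrix.isUnit_iff_isUnit_det _).1 g.isUnit).ne_zero, (hS g).1 hg⟩
  · rintro ⟨hw, hwS⟩
    exact ⟨Matrix.GeneralLinearGroup.mkOfDetNeZero _ hw, (hS _).2 hwS, rfl⟩

variable {G : Type*} [Group G] (ρ : G →* GL (Fin n) ℝ)

theorem IsAlgebraicSubgroup.isSemialgebraic_range_matrixCoords (hρ : IsAlgebraicSubgroup ρ.range)
    (q : ℕ) : IsSemialgebraic (Set.range (matrixCoords ρ q)) := by
  have h : Set.range (matrixCoords ρ q) = ⋂ i ∈ (Finset.univ : Finset (Fin q)),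
      (fun w : Fin q × Fin n × Fin n → ℝ => w ∘ Prod.mk i) ⁻¹'
        ((fun (g : GL (Fin n) ℝ) (k : Fin n × Fin n) => g k.1 k.2) '' ρ.range) := by
    ext w
    simp only [Set.mem_range, Finset.mem_univ, Set.iInter_true, Set.mem_iInter, Set.mem_preimage]
    constructor
    · rintro ⟨x, rfl⟩ i
      exact ⟨ρ (x i), ⟨x i, rfl⟩, rfl⟩
    · intro hw
      choose u hu huw using hw
      choose x hx using hu
      refine ⟨x, funext fun ⟨i, k⟩ => ?_⟩
      exact (congrArg (fun g : GL (Fin n) ℝ => g k.1 k.2) (hx i)).trans (congrFun (huw i) k)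
  rw [h]
  exact isSetAlgebra_isSemialgebraic.biInter_mem _ fun i _ =>
    hρ.isSemialgebraic_image.preimage_comp (Prod.mk i)

/-- The subsets of `G^q` cut out by semi-algebraic conditions on the entries of the `q` matrices:
the set algebras to which the regularization is applied for matrix groups. -/
def semialgebraicSystem (q : ℕ) : Set (Set (Fin q → G)) :=
  {C | ∃ S, IsSemialgebraic S ∧ C = matrixCoords ρ q ⁻¹' S}

theorem isSemialgebraic_image_matrixCoords (hρ : IsAlgebraicSubgroup ρ.range) {q : ℕ}
    {C : Set (Fin q → G)} (hC : C ∈ semialgebraicSystem ρ q) :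
    IsSemialgebraic (matrixCoords ρ q '' C) := by
  obtain ⟨S, hS, rfl⟩ := hC
  rw [Set.image_preimage_eq_inter_range]
  exact hS.inter (hρ.isSemialgebraic_range_matrixCoords ρ q)

theorem isSetAlgebra_semialgebraicSystem (q : ℕ) : IsSetAlgebra (semialgebraicSystem ρ q) where
  empty_mem := ⟨∅, isSetAlgebra_isSemialgebraic.empty_mem, rfl⟩
  compl_mem := by
    rintro _ ⟨S, hS, rfl⟩
    exact ⟨Sᶜ, hS.compl, rfl⟩
  union_mem := by
    rintro _ _ ⟨S, hS, rfl⟩ ⟨T, hT, rfl⟩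
    exact ⟨S ∪ T, isSetAlgebra_isSemialgebraic.union_mem hS hT, rfl⟩

/-- The generic matrix of the `i`-th factor of `M_{n×n}(ℝ)^q`: its entries are the corresponding
coordinate functions. -/
noncomputable def coordMatrix (n q : ℕ) (i : Fin q) :
    Matrix (Fin n) (Fin n) (MvPolynomial (Fin q × Fin n × Fin n) ℝ) :=
  Matrix.of fun a b => X (i, a, b)

theorem mapMatrix_eval_coordMatrix (q : ℕ) (x : Fin q → G) (i : Fin q) :
    (eval (matrixCoords ρ q x)).mapMatrix (coordMatrix n q i) = ρ (x i) := by
  ext a b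
  simp [coordMatrix, matrixCoords]

theorem eval_det_coordMatrix (q : ℕ) (x : Fin q → G) (i : Fin q) :
    eval (matrixCoords ρ q x) (coordMatrix n q i).det = (ρ (x i)).val.det := by
  rw [RingHom.map_det, mapMatrix_eval_coordMatrix]

theorem preimage_mem_semialgebraicSystem {m q : ℕ} {f : (Fin m → G) → Fin q → G}
    (M : Fin q → Matrix (Fin n) (Fin n) (MvPolynomial (Fin m × Fin n × Fin n) ℝ))
    (D : MvPolynomial (Fin m × Fin n × Fin n) ℝ) (hD : ∀ x, eval (matrixCoords ρ m x) D ≠ 0)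
    (hf : ∀ x i, eval (matrixCoords ρ m x) D • (ρ (f x i)).val =
      (eval (matrixCoords ρ m x)).mapMatrix (M i))
    {C : Set (Fin q → G)} (hC : C ∈ semialgebraicSystem ρ q) :
    f ⁻¹' C ∈ semialgebraicSystem ρ m := by
  obtain ⟨S, hS, rfl⟩ := hC
  obtain ⟨T, hT, hTS⟩ := hS.exists_preimage_div (fun k => M k.1 k.2.1 k.2.2) D
  refine ⟨T, hT, Set.ext fun x => ?_⟩
  have hfx : matrixCoords ρ q (f x) = fun k => eval (matrixCoords ρ m x) (M k.1 k.2.1 k.2.2) /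
      eval (matrixCoords ρ m x) D := by
    funext k
    rw [eq_div_iff (hD x), mul_comm]
    exact congrFun (congrFun (hf x k.1) k.2.1) k.2.2
  rw [Set.mem_preimage, Set.mem_preimage, Set.mem_preimage, hTS _ (hD x), hfx]

theorem face_preimage_mem_semialgebraicSystem {q : ℕ} (i : Fin (q + 1)) {C : Set (Fin q → G)}
    (hC : C ∈ semialgebraicSystem ρ q) :
    (fun x => i.removeNth x) ⁻¹' C ∈ semialgebraicSystem ρ (q + 1) := by
  refine preimage_mem_semialgebraicSystem ρ (fun j => coordMatrix n (q + 1) (i.succAbove j)) 1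
    (fun x => ?_) (fun x j => ?_) hC
  · simp only [map_one, ne_eq, one_ne_zero, not_false_eq_true]
  · rw [mapMatrix_eval_coordMatrix, map_one, one_smul]
    rfl

theorem quot_preimage_mem_semialgebraicSystem {q : ℕ} {C : Set (Fin q → G)}
    (hC : C ∈ semialgebraicSystem ρ q) :
    (fun (x : Fin (q + 1) → G) (j : Fin q) => (x 0)⁻¹ * x j.succ) ⁻¹' C ∈
      semialgebraicSystem ρ (q + 1) := by
  refine preimage_mem_semialgebraicSystem ρ
    (fun j => (coordMatrix n (q + 1) 0).adjugate * coordMatrix n (q + 1) j.succ)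
    (coordMatrix n (q + 1) 0).det (fun x => ?_) (fun x j => ?_) hC
  · rw [eval_det_coordMatrix]
    exact ((Matrix.isUnit_iff_isUnit_det _).1 (ρ (x 0)).isUnit).ne_zero
  · rw [eval_det_coordMatrix, RingHom.map_mul, RingHom.map_adjugate, mapMatrix_eval_coordMatrix,
      mapMatrix_eval_coordMatrix, map_mul, map_inv, Units.val_mul, det_smul_inv_mul_eq_adjugate_mul]

theorem mul_right_preimage_mem_semialgebraicSystem {q : ℕ} (h : G) {C : Set (Fin q → G)}
    (hC : C ∈ semialgebraicSystem ρ q) :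
    (fun (x : Fin q → G) (j : Fin q) => x j * h) ⁻¹' C ∈ semialgebraicSystem ρ q := by
  refine preimage_mem_semialgebraicSystem ρ
    (fun j => coordMatrix n q j * (ρ h).val.map MvPolynomial.C) 1 (fun x => ?_) (fun x j => ?_) hC
  · simp only [map_one, ne_eq, one_ne_zero, not_false_eq_true]
  · have hconst : (eval (matrixCoords ρ q x)).mapMatrix ((ρ h).val.map MvPolynomial.C) =
        (ρ h).val := by
      ext a b
      simp only [RingHom.mapMatrix_apply, Matrix.map_apply, eval_C]
    rw [RingHom.map_mul, mapMatrix_eval_coordMatrix, hconst, map_one, one_smul, map_mul,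
      Units.val_mul]

variable [TopologicalSpace G] {ρ}

theorem isEmbedding_val_generalLinearGroup :
    IsEmbedding (Units.val : GL (Fin n) ℝ → Matrix (Fin n) (Fin n) ℝ) := by
  refine Units.isEmbedding_val_mk' (f := fun M => M⁻¹) (fun M hM => ?_) fun u =>
    (Matrix.coe_units_inv u).symm
  have hdet : M.det ≠ 0 := ((Matrix.isUnit_iff_isUnit_det M).1 hM).ne_zero
  refine (continuousAt_matrix_inv M ?_).continuousWithinAt
  rw [Ring.inverse_eq_inv']
  exact continuousAt_inv₀ hdet

theorem isInducing_matrixCoords (hρ : IsInducing ρ) (q : ℕ) : IsInducing (matrixCoords ρ q) := by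
  have hval : IsInducing fun (x : Fin q → G) i => (ρ (x i)).val :=
    IsInducing.piMap fun _ => isEmbedding_val_generalLinearGroup.isInducing.comp hρ
  have hentries : Function.LeftInverse
      (fun (v : Fin q × Fin n × Fin n → ℝ) i => Matrix.of fun a b => v (i, a, b))
      (fun (w : Fin q → Matrix (Fin n) (Fin n) ℝ) k => w k.1 k.2.1 k.2.2) := fun _ => rfl
  exact (hentries.isEmbedding (by fun_prop) (by fun_prop)).isInducing.comp hval

theorem isStableSystem_semialgebraicSystem (hρ : IsInducing ρ) :
    MooreCohomology.IsStableSystem (semialgebraicSystem ρ) where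
  isSetAlgebra := isSetAlgebra_semialgebraicSystem ρ
  sublevel q x U hU := by
    have hcoords := isInducing_matrixCoords hρ q
    have hcont := hcoords.continuous
    rw [hcoords.nhds_eq_comap] at hU
    obtain ⟨V, hV, hVU⟩ := hU
    obtain ⟨ε, hε, hεV⟩ := exists_setOf_sum_sq_lt_subset hV
    exact ⟨fun z => ∑ k, (matrixCoords ρ q z k - matrixCoords ρ q x k) ^ 2, by fun_prop, by simp,
      fun r => ⟨_, isSemialgebraic_setOf_sum_sq_lt (matrixCoords ρ q x) r, rfl⟩, ε, hε,
      fun _ hz => hVU (hεV hz)⟩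
  face _ i _ hC := face_preimage_mem_semialgebraicSystem ρ i hC
  quot _ _ hC := quot_preimage_mem_semialgebraicSystem ρ hC
  mul_right _ h _ hC := mul_right_preimage_mem_semialgebraicSystem ρ h hC

end MatrixGroup

theorem theoremC {G : Type*} [Group G] [TopologicalSpace G] [IsTopologicalGroup G]
    [LocallyCompactSpace G] [SecondCountableTopology G] [T2Space G]
    [MeasurableSpace G] [BorelSpace G] (μ : MeasureTheory.Measure G) [μ.IsHaarMeasure]
    {A : Type*} [AddCommGroup A] [TopologicalSpace A] [DiscreteTopology A]
    [DistribMulAction G A] [ContinuousSMul G A] :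
    (∀ (p : ℕ) (c : MooreCohomology.Hm μ A p), ∃ σ : (Fin (p + 1) → G) → A,
      MooreCohomology.Represents μ c σ ∧
      LocallyFiniteValued σ ∧
      LocallyConstantOnFullDenseOpen (MooreCohomology.powMeasure μ (p + 1)) σ) ∧
    (∀ (n : ℕ) (ρ : G →* GL (Fin n) ℝ), Topology.IsClosedEmbedding ρ →
      IsAlgebraicSubgroup ρ.range →
      ∀ (p : ℕ) (c : MooreCohomology.Hm μ A p), ∃ σ : (Fin (p + 1) → G) → A,
        MooreCohomology.Represents μ c σ ∧
        LocallyFiniteValued σ ∧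
        LocallyConstantOnFullDenseOpen (MooreCohomology.powMeasure μ (p + 1)) σ ∧
        IsSemialgebraicallyPartitioned ρ σ ∧
        ∀ᶠ x in nhds (1 : Fin (p + 1) → G), σ x = σ 1) := by
  refine ⟨fun p c => ?_, fun n ρ hρ hρa p c => ?_⟩
  · obtain ⟨σ, hσ, hfin, hconst, -, -⟩ :=
      MooreCohomology.isStableSystem_univ.exists_represents c
    exact ⟨σ, hσ, hfin, hconst⟩
  · obtain ⟨σ, hσ, hfin, hconst, ⟨P, hP, hPfin, hP𝒮, hPσ⟩, hone⟩ :=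
      (isStableSystem_semialgebraicSystem hρ.isInducing).exists_represents c
    exact ⟨σ, hσ, hfin, hconst, ⟨P, hP, hPfin,
      fun C hC => isSemialgebraic_image_matrixCoords ρ hρa (hP𝒮 C hC), hPσ⟩, hone⟩
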